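/- **Setting.** Let $T\in\mathbb N$, $\alpha\in(\tfrac12,1)$, $r>0$, $\gamma_0,\dots,\gamma_{T-1}\ge 0$. On a probability space $(\Omega,\mathcal A,\mathbb Q)$ let $N_0=0$ and let $N_{l+1}-N_l$, $0\le l<T$, be independent Poisson variables with parameters $\gamma_l$; $\mathfrak F=(\mathfrak F_k)$ is the augmented natural filtration of $N$ and $\mathbb E_k=\mathbb E[\cdot\,|\,\mathfrak F_k]$. All (in)equalities between random variables are almost sure, and sums over empty ranges are $0$. Set $$I_k=(-1)^{N_k},\qquad P_k(\ell)=\mathbb E_k[\mathbf 1_{I_\ell=-1}],\qquad \tau_s=\inf\{k: I_k=-1\}\wedge T,$$ $$Q_k=\operatorname*{ess\,sup}_{\tau}\ \mathbb E_k\sum_{\ell=k+1}^{T}(\mathbf 1_{I_\ell=-1}-\mathbf 1_{I_\ell=1})\mathbf 1_{\ell\le\tau},$$ over the $\mathfrak F$-stopping times $\tau$ with values in $\{k,\dots,T\}$. *Trader's model.* At time $k<\tau_s$ (so $I_k=1$) the trader uses the process $i^k_l=\mathbf 1_{n^k_l=0}-\mathbf 1_{n^k_l\ge1}$, $k\le l\le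 T$, where $n^k_k=0$ and $n^k$ has independent Poisson increments $n^k_{l+1}-n^k_l$ with parameters $\nu^k_l$ calibrated by $1-\exp(-\sum_{l=k}^{\ell-1}\nu^k_l)=P_k(\ell)$, $k<\ell\le T$. Let $q_k$ be the supremum, over the $\{k,\dots,T\}$-valued stopping times $\theta$ of the natural filtration of $n^k$, of the expectation in that model of $\sum_{\ell=k+1}^T(\mathbf 1_{i^k_\ell=-1}-\mathbf 1_{i^k_\ell=1})\mathbf 1_{\ell\le\theta}$. Fix any optimal rule $\theta^0$ in the time-$0$ model and put, with expectations $\mathbb E^{tr}$ in that model, $$a_0(\ell)=\frac{\mathbb E^{tr}[\mathbf 1_{i^0_\ell=-1}\mathbf 1_{\ell\le\theta^0}]}{P_0(\ell)},\qquad b_0(\ell)=\frac{\mathbb E^{tr}[\mathbf 1_{i^0_\ell=1}\mathbf 1_{\ell\le\theta^0}]}{1-P_0(\ell)}$$ ($a_0(\ell):=0$ if $P_0(\ell)=0$). *Bad trader.* Let $\tau_e=\inf\{k<\tau_s: q_k=0\}\wedge\tau_s$, $J^s_k=\mathbf 1_{k<\tau_s}$, $J^e_k=\mathbf 1_{k<\tau_e}$,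 and $$\mathcal Q_k=\sum_{l=1}^k(\mathbf 1_{I_l=-1}-\mathbf 1_{I_l=1})\mathbf 1_{l\le\tau_e},\quad \mathcal P_k=\sum_{\ell=1}^k\big(a_0(\ell)\mathbf 1_{I_\ell=-1}-b_0(\ell)\mathbf 1_{I_\ell=1}\big),\quad P_k=\mathbb E_k[\mathcal P_T-\mathcal P_k].$$ Write $X^{\tau_e}_k=X_{k\wedge\tau_e}$, and define $$pnl_k=\mathcal Q^{\tau_e}_k+(J^sq+(1-J^s)Q)^{\tau_e}_k-(\mathcal P+J^sP+(1-J^s)P)^{\tau_e}_k-(1-J^e_k)\big(J^s_{\tau_e}q_{\tau_e}+(1-J^s_{\tau_e})Q_{\tau_e}\big),$$ $$HVA_k=pnl_k-\mathbb E_k\,pnl_T,\qquad EC_k=\mathbb{ES}_k(L_k),\qquad KVA_k=r\,\mathbb E_k\sum_{l=k}^{T-1}e^{-r(l-k)}EC_l,$$ where $L_k=-(pnl_{(k+1)\wedge T}-pnl_k)+HVA_{(k+1)\wedge T}-HVA_k$ and $\mathbb{ES}_k$ is the expected shortfall at level $\alpha$ of the $\mathfrak F_k$-conditional law (the mean loss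 given that the loss is $\ge$ its lower $\alpha$-quantile). Let further $D_k=\mathbb E_k[J^s_{\tau_e}Q_{\tau_e}]$, $D'_k=\mathbb E_k[(1-J^s_{\tau_e})Q_{\tau_e}]$, $K_k=-\sum_{j<k}\mathbb E_j[(\mathcal Q+Q)_{j+1}-(\mathcal Q+Q)_j]$ (so that $\mathcal Q+Q+K$ is a martingale), and $va(K^{\tau_e})_k=\mathbb E_k[K^{\tau_e}_T-K^{\tau_e}_k]$. **Proposition.** For each $0\le k\le T$, writing $k^+=(k+1)\wedge T$: **(i)** $$pnl_k=\mathcal Q^{\tau_e}_k+(J^sq)^{\tau_e}_k+((1-J^s)Q)^{\tau_e}_k-(\mathcal P+P)^{\tau_e}_k-(1-J^e_k)(1-J^s_{\tau_e})Q_{\tau_e},$$ $$HVA_k=(J^s(q-Q))^{\tau_e}_k+D_k+J^e_kD'_k+va(K^{\tau_e})_k,\qquad va(K^{\tau_e})_k=(\mathcal Q+Q)^{\tau_e}_k-\mathbb E_k[\mathcal Q_{\tau_e}+Q_{\tau_e}],$$ $$HVA_0=(q_0-Q_0)+D_0+D'_0+va(K^{\tau_e})_0,$$ $$-pnl_k+(HVA_k-HVA_0)=-(\mathcal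 Q+Q)^{\tau_e}_k+(\mathcal P+P)^{\tau_e}_k+(1-J^e_k)(1-J^s_{\tau_e})Q_{\tau_e}+D_k+J^e_kD'_k+va(K^{\tau_e})_k+(Q_0-P_0)-(D_0+D'_0+va(K^{\tau_e})_0),$$ $$HVA_{k^+}-HVA_k-(pnl_{k^+}-pnl_k)=-(\mathcal Q+Q)^{\tau_e}_{k+1}+(\mathcal P+P)^{\tau_e}_{k+1}+(\mathcal Q+Q)^{\tau_e}_k-(\mathcal P+P)^{\tau_e}_k+(J^e_k-J^e_{k^+})(1-J^s_{\tau_e})Q_{\tau_e}$$ $$\qquad+D_{k^+}+J^e_{k^+}D'_{k^+}+va(K^{\tau_e})_{k^+}-D_k-J^e_kD'_k-va(K^{\tau_e})_k.$$ **(ii)** Let $\Omega_l=\{I_0=\dots=I_{l-1}=1,\ I_l=-1\}$ for $1\le l\le T$ and $\Omega_{T+1}=\{I_0=\dots=I_T=1\}$. Then $pnl_k$, $HVA_k$ and $-pnl_k+(HVA_k-HVA_0)$ are constant on each $\Omega_l$. Their values there are obtained from the formulas in (i) by inserting the following. Let $u_l=\frac12(1+e^{-2\gamma_{l-1}})$,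 $v_l=\frac12(1-e^{-2\gamma_{l-1}})$. Let $Q(T,\mp1)=0$ and, for $k<T$, $$Q(k,-1)=e^{-2\gamma_k}+v_{k+1}Q(k+1,1)+u_{k+1}Q(k+1,-1),$$ $$Q(k,1)=\max\big(0,-e^{-2\gamma_k}+u_{k+1}Q(k+1,1)+v_{k+1}Q(k+1,-1)\big).$$ With $\nu^k$ calibrated as above to $P_k(\ell)=\frac12(1-e^{-2\sum_{j=k}^{\ell-1}\gamma_j})$, let $q^k(T,\mp1)=0$, $q^k(l,-1)=T-l$ and, for $k\le l<T$, $$q^k(l,1)=\max\big(0,e^{-\nu^k_l}(-1+q^k(l+1,1))+(1-e^{-\nu^k_l})(1+q^k(l+1,-1))\big).$$ On $\Omega_l$: $I_j=1$ for $j<l$, $j\le T$, and $I_l=-1$ if $l\le T$; $\tau_s=l\wedge T$; $\tau_e=\inf\{j<l\wedge T: q^j(j,1)=0\}\wedge(l\wedge T)$; $Q_j=Q(j,I_j)$ and $P_j=\sum_{\ell>j}^{T}\big(a_0(\ell)P_j(\ell)-b_0(\ell)(1-P_j(\ell))\big)$ for $j\le\tau_e$, with $P_j(\ell)=\frac12(1-I_j\,e^{-2\sum_{i=j}^{\ell-1}\gamma_i})$;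 $q_j=q^j(j,1)$ for $j\le\tau_e$, $j<\tau_s$. For $\xi$ any of $J^s_{\tau_e}Q_{\tau_e}$, $(1-J^s_{\tau_e})Q_{\tau_e}$, $\mathcal Q_{\tau_e}+Q_{\tau_e}$, the value of $\mathbb E_k\xi$ on $\Omega_l$ is $\sum_{\lambda=1}^{T+1}\xi(\Omega_\lambda)\,\mathbb Q_k[\Omega_\lambda](\Omega_l)$, where $$\mathbb Q_k[\Omega_\lambda](\Omega_l)=\mathbf 1_{k\ge\lambda}\mathbf 1_{l=\lambda}+\mathbf 1_{k<\lambda}\mathbf 1_{l>k}\Big(\prod_{m=k+1}^{\lambda-1}u_m\Big)v_\lambda\quad(\lambda\le T),\qquad \mathbb Q_k[\Omega_{T+1}](\Omega_l)=\mathbf 1_{l>k}\prod_{m=k+1}^Tu_m.$$ **(iii)** There are constants $EC(0),\dots,EC(T)$ such that, for each $k\le T$ and $1\le l\le T+1$, $EC_k=0$ on $\Omega_l$ if $l\le k$, and $EC_k=EC(k)$ on $\Omega_l$ if $l>k$. Moreover $$KVA_0=r\sum_{k=0}^{T-1}e^{-rk}\,EC(k)\sum_{\lambda=k+1}^{T+1}\mathbb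 Q[\Omega_\lambda].$$ -/

import Mathlib

open MeasureTheory ProbabilityTheory Finset
open scoped NNReal

namespace RangeAccrual

noncomputable section

open Classical in
/-- Real-valued indicator of a proposition. -/
def ind (p : Prop) : ℝ := if p then 1 else 0

/-! ### General probabilistic notions -/

/-- `Y` is an essential supremum of the family `S` of random variables. -/
def IsEssSup {Ω : Type*} {mΩ : MeasurableSpace Ω} (μ : Measure Ω) (S : Set (Ω → ℝ))
    (Y : Ω → ℝ) : Prop :=
  AEMeasurable Y μ ∧ (∀ X ∈ S, X ≤ᵐ[μ] Y) ∧
    ∀ Z : Ω → ℝ, AEMeasurable Z μ → (∀ X ∈ S, X ≤ᵐ[μ] Z) → Y ≤ᵐ[μ] Z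

open Classical in
/-- The essential supremum of a family of random variables (a version of it; unique up to
almost sure equality, and `0` if there is none). -/
def essSupFamily {Ω : Type*} {mΩ : MeasurableSpace Ω} (μ : Measure Ω) (S : Set (Ω → ℝ)) :
    Ω → ℝ :=
  if h : ∃ Y, IsEssSup μ S Y then h.choose else 0

/-- Value-at-risk at level `α` of a loss with law `ρ` : the (lower) `α`-quantile. -/
def valueAtRisk (α : ℝ) (ρ : Measure ℝ) : ℝ := sInf {x : ℝ | α ≤ ρ.real (Set.Iic x)}

/-- Expected shortfall (tail conditional expectation) at level `α` of a loss with law `ρ` :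
the mean loss, given that the loss is at least its value-at-risk. -/
def expectedShortfall (α : ℝ) (ρ : Measure ℝ) : ℝ :=
  (∫ x in Set.Ici (valueAtRisk α ρ), x ∂ρ) / ρ.real (Set.Ici (valueAtRisk α ρ))

/-- Expected shortfall of the conditional law of `X` given the σ-algebra `m`. The conditional law
is the regular conditional distribution of `X` given the identity map from `Ω` to `(Ω, m)`. -/
def condExpectedShortfall {Ω : Type*} {mΩ : MeasurableSpace Ω} (α : ℝ) (μ : Measure Ω)
    [IsFiniteMeasure μ] (m : MeasurableSpace Ω) (X : Ω → ℝ) (ω : Ω) : ℝ :=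
  expectedShortfall α (@condDistrib Ω Ω ℝ _ _ _ mΩ m X id μ _ ω)

/-! ### The trader's model, calibrated at time `k` to a curve `p` of binary prices -/

/-- `∑ l ∈ Ico k ℓ, ν l` for the intensities `ν` solving
`1 - exp (- ∑ l ∈ Ico k ℓ, ν l) = p ℓ` for all `ℓ > k`. -/
def cumIntensity (p : ℕ → ℝ) (k ℓ : ℕ) : ℝ := if ℓ ≤ k then 0 else -Real.log (1 - p ℓ)

/-- The intensities `ν l`, `l ≥ k`, calibrated at time `k` to the prices `p ℓ`, `ℓ > k`. -/
def calibRate (p : ℕ → ℝ) (k l : ℕ) : ℝ := cumIntensity p k (l + 1) - cumIntensity p k l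

/-- Law of the sequence of independent Poisson increments with parameters `ν l`. -/
def traderLaw (ν : ℕ → ℝ) : Measure (ℕ → ℕ) :=
  Measure.infinitePi fun l => poissonMeasure (ν l).toNNReal

/-- The process `n^k`, with `n^k_k = 0`, on the space of increment sequences. -/
def traderCount (k l : ℕ) (x : ℕ → ℕ) : ℕ := ∑ j ∈ Ico k l, x j

/-- The regime process `i^k` of the trader's model, started from the value `s` at time `k` ;
the regime `-1` is absorbing. -/
def traderRegime (k : ℕ) (s : ℤ) (l : ℕ) (x : ℕ → ℕ) : ℤ :=
  if s = -1 then -1 else if traderCount k l x = 0 then 1 else -1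

/-- The natural filtration of `n^k`. -/
def traderFiltration (k : ℕ) : Filtration ℕ (inferInstance : MeasurableSpace (ℕ → ℕ)) :=
  Filtration.natural (fun l x => traderCount k l x) fun _ =>
    (Finset.measurable_sum _ fun j _ => measurable_pi_apply j).stronglyMeasurable

/-- Exercise rules available from time `k` on in the trader's model. -/
def IsTraderRule (k T : ℕ) (θ : (ℕ → ℕ) → ℕ) : Prop :=
  IsStoppingTime (traderFiltration k) (fun x => (θ x : WithTop ℕ)) ∧ ∀ x, k ≤ θ x ∧ θ x ≤ T

/-- Expected cash flow after time `k`, in the trader's model, under the exercise rule `θ`. -/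
def traderReward (p : ℕ → ℝ) (k T : ℕ) (s : ℤ) (θ : (ℕ → ℕ) → ℕ) : ℝ :=
  ∫ x, ∑ ℓ ∈ Ioc k T,
    (ind (traderRegime k s ℓ x = -1) - ind (traderRegime k s ℓ x = 1)) * ind (ℓ ≤ θ x)
    ∂(traderLaw (calibRate p k))

/-- Value of the callable asset in the trader's model. -/
def traderValue (p : ℕ → ℝ) (k T : ℕ) (s : ℤ) : ℝ :=
  sSup {v | ∃ θ, IsTraderRule k T θ ∧ v = traderReward p k T s θ}

/-- `θ` is an optimal exercise rule in the trader's model. -/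
def IsOptimalTraderRule (p : ℕ → ℝ) (k T : ℕ) (s : ℤ) (θ : (ℕ → ℕ) → ℕ) : Prop :=
  IsTraderRule k T θ ∧ ∀ θ', IsTraderRule k T θ' → traderReward p k T s θ' ≤ traderReward p k T s θ

/-! ### The market, the asset and the bad trader -/

section Market

variable {Ω : Type*} {mΩ : MeasurableSpace Ω} (μ : Measure Ω) (N : ℕ → Ω → ℕ) (T : ℕ)

/-- The augmented natural filtration of `N` : a set belongs to `𝔉_k` if it is measurable and
almost surely equal to a set of the σ-algebra generated by `N_0, …, N_k`. -/
def filt : Filtration ℕ mΩ where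
  seq k := @eventuallyMeasurableSpace Ω (⨆ j ≤ k, MeasurableSpace.comap (N j) ⊤) (ae μ) _ ⊓ mΩ
  mono' := by
    intro i j hij s hs
    obtain ⟨⟨t, ht, hst⟩, hm⟩ := MeasurableSpace.measurableSet_inf.1 hs
    refine MeasurableSpace.measurableSet_inf.2 ⟨⟨t, ?_, hst⟩, hm⟩
    have hle : (⨆ a ≤ i, MeasurableSpace.comap (N a) ⊤) ≤
        ⨆ a ≤ j, MeasurableSpace.comap (N a) ⊤ :=
      biSup_mono fun a ha => le_trans ha hij
    exact hle t ht
  le' _ := inf_le_right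

/-- The market regime `I_k = (-1)^{N_k}`, with `I_0 = 1` ; `-1` is the extreme regime. -/
def regime (k : ℕ) (ω : Ω) : ℤ := (-1) ^ N k ω

/-- `P_k(ℓ)` : the time-`k` fair valuation of the binary option with payoff `𝟙{I_ℓ = -1}`. -/
def binaryPrice (k ℓ : ℕ) : Ω → ℝ := μ[fun ω => ind (regime N ℓ ω = -1) | filt μ N k]

/-- `P_0(ℓ)`, as a constant. -/
def binaryPrice0 (ℓ : ℕ) : ℝ := μ.real {ω | regime N ℓ ω = -1}

/-- Stopping times with values in `{k, …, T}`. -/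
def IsRule (k : ℕ) (τ : Ω → ℕ) : Prop :=
  IsStoppingTime (filt μ N) (fun ω => (τ ω : WithTop ℕ)) ∧ ∀ ω, k ≤ τ ω ∧ τ ω ≤ T

/-- `Q_k` : the fair callable value of the asset. -/
def fairValue (k : ℕ) : Ω → ℝ :=
  essSupFamily μ {Y | ∃ τ, IsRule μ N T k τ ∧
    Y = μ[fun ω => ∑ ℓ ∈ Ioc k T,
      (ind (regime N ℓ ω = -1) - ind (regime N ℓ ω = 1)) * ind (ℓ ≤ τ ω) | filt μ N k]}

/-- `q_k` : the value of the asset in the trader's model started from `I_k` and recalibrated at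
time `k` to the prices `P_k(·)` (only used before the model switch time). -/
def traderPrice (k : ℕ) (ω : Ω) : ℝ :=
  traderValue (fun ℓ => binaryPrice μ N k ℓ ω) k T (regime N k ω)

/-- The model switch time `τ_s = inf {k ; I_k = -1} ∧ T`. -/
def switchTime (ω : Ω) : ℕ := sInf {k | k = T ∨ regime N k ω = -1}

/-- The bad trader's exit time `τ_e = inf {k < τ_s ; q_k = 0} ∧ τ_s`. -/
def exitTime (ω : Ω) : ℕ :=
  sInf {k | k = switchTime N T ω ∨ (k < switchTime N T ω ∧ traderPrice μ N T k ω = 0)}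

/-- `J^s_k = 𝟙{k < τ_s}`. -/
def Js (k : ℕ) (ω : Ω) : ℝ := ind (k < switchTime N T ω)

/-- `J^e_k = 𝟙{k < τ_e}`. -/
def Je (k : ℕ) (ω : Ω) : ℝ := ind (k < exitTime μ N T ω)

/-- The range accrual cash flow `𝒬`. -/
def assetFlow (k : ℕ) (ω : Ω) : ℝ :=
  ∑ l ∈ Icc 1 k,
    (ind (regime N l ω = -1) - ind (regime N l ω = 1)) * ind (l ≤ exitTime μ N T ω)

/-- The process `X` stopped at `τ_e` : `X_{k ∧ τ_e}`. -/
def stopped (X : ℕ → Ω → ℝ) (k : ℕ) (ω : Ω) : ℝ := X (min k (exitTime μ N T ω)) ω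

/-- The value `X_{τ_e}`. -/
def atExit (X : ℕ → Ω → ℝ) (ω : Ω) : ℝ := X (exitTime μ N T ω) ω

/-- The drift `K` of `𝒬 + Q` : the predictable process with `K_0 = 0` that makes `𝒬 + Q + K` a
martingale. -/
def drift (k : ℕ) (ω : Ω) : ℝ :=
  -predictablePart (fun j ω' => assetFlow μ N T j ω' + fairValue μ N T j ω') (filt μ N) μ k ω

/-- The fair value `va(K^{τ_e})_k = 𝔼_k[K_{T ∧ τ_e} - K_{k ∧ τ_e}]`. -/
def vaDrift (k : ℕ) : Ω → ℝ :=
  μ[fun ω => stopped μ N T (drift μ N T) T ω - stopped μ N T (drift μ N T) k ω | filt μ N k]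

/-- `D_k = 𝔼_k[J^s_{τ_e} Q_{τ_e}]`. -/
def DProc (k : ℕ) : Ω → ℝ :=
  μ[fun ω => atExit μ N T (Js N T) ω * atExit μ N T (fairValue μ N T) ω | filt μ N k]

/-- `D'_k = 𝔼_k[(1 - J^s_{τ_e}) Q_{τ_e}]`. -/
def DProc' (k : ℕ) : Ω → ℝ :=
  μ[fun ω => (1 - atExit μ N T (Js N T) ω) * atExit μ N T (fairValue μ N T) ω | filt μ N k]

/-! In what follows, `θ` is the exercise rule that the trader uses in his time-`0` model. -/

variable (θ : (ℕ → ℕ) → ℕ)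

/-- The hedging ratio `a_0(ℓ)`. -/
def hedgeA (ℓ : ℕ) : ℝ :=
  (∫ x, ind (traderRegime 0 1 ℓ x = -1) * ind (ℓ ≤ θ x)
    ∂(traderLaw (calibRate (binaryPrice0 μ N) 0))) / binaryPrice0 μ N ℓ

/-- The hedging ratio `b_0(ℓ)`. -/
def hedgeB (ℓ : ℕ) : ℝ :=
  (∫ x, ind (traderRegime 0 1 ℓ x = 1) * ind (ℓ ≤ θ x)
    ∂(traderLaw (calibRate (binaryPrice0 μ N) 0))) / (1 - binaryPrice0 μ N ℓ)

/-- The cash flow `𝒫` of the bad trader's static hedge. -/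
def hedgeFlow (k : ℕ) (ω : Ω) : ℝ :=
  ∑ ℓ ∈ Icc 1 k,
    (hedgeA μ N θ ℓ * ind (regime N ℓ ω = -1) - hedgeB μ N θ ℓ * ind (regime N ℓ ω = 1))

/-- The fair value `P` of the bad trader's static hedge. -/
def hedgePrice (k : ℕ) : Ω → ℝ :=
  μ[fun ω => ∑ ℓ ∈ Ioc k T,
    (hedgeA μ N θ ℓ * ind (regime N ℓ ω = -1) - hedgeB μ N θ ℓ * ind (regime N ℓ ω = 1))
    | filt μ N k]

/-- The (raw) profit-and-loss process of the bad trader. -/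
def pnl (k : ℕ) (ω : Ω) : ℝ :=
  stopped μ N T (assetFlow μ N T) k ω
    + stopped μ N T (Js N T) k ω * stopped μ N T (traderPrice μ N T) k ω
    + (1 - stopped μ N T (Js N T) k ω) * stopped μ N T (fairValue μ N T) k ω
    - (stopped μ N T (hedgeFlow μ N θ) k ω
      + stopped μ N T (Js N T) k ω * stopped μ N T (hedgePrice μ N T θ) k ω
      + (1 - stopped μ N T (Js N T) k ω) * stopped μ N T (hedgePrice μ N T θ) k ω)
    - (1 - Je μ N T k ω)
      * (atExit μ N T (Js N T) ω * atExit μ N T (traderPrice μ N T) ω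
        + (1 - atExit μ N T (Js N T) ω) * atExit μ N T (fairValue μ N T) ω)

/-- The hedging valuation adjustment `HVA_k = pnl_k - 𝔼_k[pnl_T]`. -/
def hva (k : ℕ) (ω : Ω) : ℝ :=
  pnl μ N T θ k ω - (μ[pnl μ N T θ T | filt μ N k]) ω

/-- The loss of the HVA-compensated `pnl` between `k` and `(k + 1) ∧ T`. -/
def lossIncr (k : ℕ) (ω : Ω) : ℝ :=
  -(pnl μ N T θ (min (k + 1) T) ω - pnl μ N T θ k ω)
    + hva μ N T θ (min (k + 1) T) ω - hva μ N T θ k ω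

/-- The economic capital `EC_k`. -/
def econCapital [IsFiniteMeasure μ] (α : ℝ) (k : ℕ) : Ω → ℝ :=
  condExpectedShortfall α μ (filt μ N k) (lossIncr μ N T θ k)

/-- The capital valuation adjustment `KVA_k`, with hurdle rate `r`. -/
def kva [IsFiniteMeasure μ] (α r : ℝ) (k : ℕ) (ω : Ω) : ℝ :=
  r * (μ[fun ω' => ∑ l ∈ Ico k T,
    Real.exp (-r * ((l : ℝ) - k)) * econCapital μ N T θ α l ω' | filt μ N k]) ω

/-- The event `Ω_l`, `1 ≤ l ≤ T + 1`, that the extreme regime first occurs at time `l`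
(not at all up to `T` if `l = T + 1`). -/
def firstEvent (l : ℕ) : Set Ω :=
  {ω | (∀ j < l, regime N j ω = 1) ∧ (l ≤ T → regime N l ω = -1)}

end Market

/-! ### Explicit values on the events `Ω_l`

These only involve the Poisson parameters `γ`, the maturity `T` and the hedging ratios `a`, `b`. -/

section Explicit

variable (γ : ℕ → ℝ≥0) (T : ℕ)

/-- `u_l`, the probability that `N_l - N_{l-1}` is even. -/
def uProb (l : ℕ) : ℝ := (1 + Real.exp (-2 * γ (l - 1))) / 2

/-- `v_l`, the probability that `N_l - N_{l-1}` is odd. -/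
def vProb (l : ℕ) : ℝ := (1 - Real.exp (-2 * γ (l - 1))) / 2

/-- The value on `Ω_l` of the conditional probability of `Ω_m` given `𝔉_k`. -/
def condProbVal (k m l : ℕ) : ℝ :=
  if m ≤ T then
    ind (m ≤ k) * ind (l = m)
      + ind (k < m) * ind (k < l) * (∏ j ∈ Ioo k m, uProb γ j) * vProb γ m
  else ind (k < l) * ∏ j ∈ Ioc k T, uProb γ j

/-- The binary price `P_k(ℓ)` in the regime `I_k = s`. -/
def binaryVal (k ℓ : ℕ) (s : ℤ) : ℝ :=
  if s = 1 then (1 - Real.exp (-2 * ∑ j ∈ Ico k ℓ, (γ j : ℝ))) / 2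
  else (1 + Real.exp (-2 * ∑ j ∈ Ico k ℓ, (γ j : ℝ))) / 2

/-- Backward dynamic programming for the fair pricing function, in terms of the time `n` to
maturity : `fairDP γ T n s = Q(T - n, s)`. -/
def fairDP : ℕ → ℤ → ℝ
  | 0, _ => 0
  | n + 1, s =>
    if s = -1 then
      Real.exp (-2 * γ (T - (n + 1))) + vProb γ (T - n) * fairDP n 1
        + uProb γ (T - n) * fairDP n (-1)
    else
      max 0 (-Real.exp (-2 * γ (T - (n + 1))) + uProb γ (T - n) * fairDP n 1
        + vProb γ (T - n) * fairDP n (-1))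

/-- The fair pricing function `Q(k, s)`. -/
def fairVal (k : ℕ) (s : ℤ) : ℝ := fairDP γ T (T - k) s

/-- Backward dynamic programming for the pricing function of the trader's model with intensities
`ν`, in terms of the time `n` to maturity. -/
def traderDP (ν : ℕ → ℝ) : ℕ → ℤ → ℝ
  | 0, _ => 0
  | n + 1, s =>
    if s = -1 then (n : ℝ) + 1
    else
      max 0 (Real.exp (-ν (T - (n + 1))) * (-1 + traderDP ν n 1)
        + (1 - Real.exp (-ν (T - (n + 1)))) * (1 + traderDP ν n (-1)))

/-- The pricing function `q^k(l, s)` of the trader's model calibrated at time `k`, `I_k = 1`. -/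
def traderVal (k l : ℕ) (s : ℤ) : ℝ :=
  traderDP T (calibRate (fun ℓ => binaryVal γ k ℓ 1) k) (T - l) s

/-- The value `τ_s(Ω_l) = l ∧ T`. -/
def switchVal (l : ℕ) : ℕ := min l T

/-- The value `τ_e(Ω_l) = inf {k < l ∧ T ; q^k(k, 1) = 0} ∧ (l ∧ T)`. -/
def exitVal (l : ℕ) : ℕ :=
  sInf {k | k = switchVal T l ∨ (k < switchVal T l ∧ traderVal γ T k k 1 = 0)}

/-- The value `I_k(Ω_l)`, for `k ≤ l ∧ T`. -/
def regimeVal (l k : ℕ) : ℤ := if k = l then -1 else 1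

/-- `J^s_{k ∧ τ_e}(Ω_l)`. -/
def JsVal (l k : ℕ) : ℝ := ind (min k (exitVal γ T l) < switchVal T l)

/-- `J^e_k(Ω_l)`. -/
def JeVal (l k : ℕ) : ℝ := ind (k < exitVal γ T l)

/-- `𝒬_{k ∧ τ_e}(Ω_l)`. -/
def assetFlowVal (l k : ℕ) : ℝ :=
  ∑ ℓ ∈ Icc 1 (min k (exitVal γ T l)), (ind (regimeVal l ℓ = -1) - ind (regimeVal l ℓ = 1))

/-- `Q_{k ∧ τ_e}(Ω_l)`. -/
def fairStopVal (l k : ℕ) : ℝ :=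
  fairVal γ T (min k (exitVal γ T l)) (regimeVal l (min k (exitVal γ T l)))

/-- `q_{k ∧ τ_e}(Ω_l)`, when `k ∧ τ_e(Ω_l) < τ_s(Ω_l)`. -/
def traderStopVal (l k : ℕ) : ℝ :=
  traderVal γ T (min k (exitVal γ T l)) (min k (exitVal γ T l)) 1

/-- `D_k(Ω_l)`. -/
def DVal (l k : ℕ) : ℝ :=
  ∑ m ∈ Icc 1 (T + 1), JsVal γ T m T * fairStopVal γ T m T * condProbVal γ T k m l

/-- `D'_k(Ω_l)`. -/
def DVal' (l k : ℕ) : ℝ :=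
  ∑ m ∈ Icc 1 (T + 1), (1 - JsVal γ T m T) * fairStopVal γ T m T * condProbVal γ T k m l

/-- `va(K^{τ_e})_k(Ω_l)`. -/
def vaDriftVal (l k : ℕ) : ℝ :=
  assetFlowVal γ T l k + fairStopVal γ T l k
    - ∑ m ∈ Icc 1 (T + 1), (assetFlowVal γ T m T + fairStopVal γ T m T) * condProbVal γ T k m l

/-- `HVA_k(Ω_l)`. -/
def hvaVal (l k : ℕ) : ℝ :=
  JsVal γ T l k * (traderStopVal γ T l k - fairStopVal γ T l k)
    + DVal γ T l k + JeVal γ T l k * DVal' γ T l k + vaDriftVal γ T l k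

variable (a b : ℕ → ℝ)

/-- `𝒫_{k ∧ τ_e}(Ω_l)`. -/
def hedgeFlowVal (l k : ℕ) : ℝ :=
  ∑ ℓ ∈ Icc 1 (min k (exitVal γ T l)),
    (a ℓ * ind (regimeVal l ℓ = -1) - b ℓ * ind (regimeVal l ℓ = 1))

/-- `P_{k ∧ τ_e}(Ω_l)`. -/
def hedgePriceVal (l k : ℕ) : ℝ :=
  ∑ ℓ ∈ Ioc (min k (exitVal γ T l)) T,
    (a ℓ * binaryVal γ (min k (exitVal γ T l)) ℓ (regimeVal l (min k (exitVal γ T l)))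
      - b ℓ * (1 - binaryVal γ (min k (exitVal γ T l)) ℓ
          (regimeVal l (min k (exitVal γ T l)))))

/-- `pnl_k(Ω_l)`. -/
def pnlVal (l k : ℕ) : ℝ :=
  assetFlowVal γ T l k + JsVal γ T l k * traderStopVal γ T l k
    + (1 - JsVal γ T l k) * fairStopVal γ T l k
    - (hedgeFlowVal γ T a b l k + hedgePriceVal γ T a b l k)
    - (1 - JeVal γ T l k) * ((1 - JsVal γ T l T) * fairStopVal γ T l T)

end Explicit

end

end RangeAccrual

open RangeAccrual

namespace RangeAccrual

/-! Two facts carry the proof. First, by independence of the increments, `(-1) ^ N` has one-step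
conditional mean `exp (-2 * γ j)` times its current value (`IsMarket.condExp_mul_sgn_succ`). Every
function of a two-valued regime is affine in its sign, so this single formula yields all prices of
functions of a later regime, and also the one-step operators of dynamic programming.

Secondly, the bad trader leaves no later than the first visit to the extreme regime. Before that
visit the path of the regime is constant, so every process stopped at `τ_e` is almost surely a
deterministic function of `firstTime` (the structure `IsRegular` and its lemmas). Conditional
expectations of such functions are finite sums with weights `condProbVal`, obtained by backward
induction (`IsMarket.condExp_firstTime`).

The two optimal stopping problems are solved by one verification argument: a nonnegative
supersolution of the dynamic programming equation bounds all rules (`condExp_stoppedSum_le`), and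
stopping when the value first vanishes attains the bound (`exists_condExp_stoppedSum_eq`). It is
applied to the fair model and to the trader's model. The latter, with its calibrated intensities,
makes the trader's price deterministic in the normal regime.

For (i), `J^s q` vanishes at the exit, since the exit happens either at the switch or when `q = 0`.
The final `pnl` is thus the stopped asset flow minus the stopped hedge, and the hedge is a
martingale. Telescoping `𝒬 + Q` along the exit time identifies the drift adjustment, and what
remains is the algebra of `hvaVal_eq`. At time `0` the hedge costs `q_0`, because the ratios `a_0`,
`b_0` reproduce the trader's expected flows date by date.

For (iii), the compensated loss is a martingale increment of the final `pnl`. It is null once the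
extreme regime has been visited, and before that its conditional law does not depend on the
scenario. -/

lemma ind_of_true {p : Prop} (h : p) : ind p = 1 := if_pos h

lemma ind_of_false {p : Prop} (h : ¬ p) : ind p = 0 := if_neg h

lemma ind_congr {p q : Prop} (h : p ↔ q) : ind p = ind q := by rw [propext h]

lemma ind_nonneg (p : Prop) : 0 ≤ ind p := by
  by_cases h : p
  · simp [ind_of_true h]
  · simp [ind_of_false h]

lemma ind_le_one (p : Prop) : ind p ≤ 1 := by
  by_cases h : p
  · simp [ind_of_true h]
  · simp [ind_of_false h]

lemma measurable_ind {Ω : Type*} {m : MeasurableSpace Ω} {p : Ω → Prop}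
    (hp : MeasurableSet {ω | p ω}) : Measurable fun ω => ind (p ω) := by
  classical
  exact Measurable.ite hp measurable_const measurable_const

/-! ### Stopping and optimal stopping -/

section Stopping

variable {Ω : Type*} {mΩ : MeasurableSpace Ω} {μ : Measure Ω}
  (F : Filtration ℕ mΩ)

/-- Discrete stochastic integral form of stopping. The integrand `ind (j < t)` is known at time `j`
when `t` is a stopping time, so it comes out of a conditional expectation given the past. -/
lemma stopped_sub_eq_sum (X : ℕ → ℝ) (t : ℕ) {k n : ℕ} (hkn : k ≤ n) :
    X (min n t) - X (min k t) = ∑ j ∈ Ico k n, ind (j < t) * (X (j + 1) - X j) := by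
  induction n, hkn using Nat.le_induction with
  | base => simp
  | succ n hn ih =>
    rw [Finset.sum_Ico_succ_top hn, ← ih]
    by_cases h : n < t
    · rw [ind_of_true h, min_eq_left h.le, min_eq_left (Nat.succ_le_of_lt h)]
      ring
    · rw [ind_of_false h, min_eq_right (not_lt.1 h), min_eq_right (by omega)]
      ring

lemma integrable_ind_mul {m : MeasurableSpace Ω} (hm : m ≤ mΩ) {p : Ω → Prop} {f : Ω → ℝ}
    (hp : AEStronglyMeasurable[m] (fun ω => ind (p ω)) μ) (hf : Integrable f μ) :
    Integrable (fun ω => ind (p ω) * f ω) μ := by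
  refine hf.bdd_mul (c := 1) (hp.mono hm) (Filter.Eventually.of_forall fun ω => ?_)
  rw [Real.norm_eq_abs, abs_of_nonneg (ind_nonneg _)]
  exact ind_le_one _

lemma IsStoppingTime.aestronglyMeasurable_ind_lt {F : Filtration ℕ mΩ} {τ : Ω → ℕ}
    (hτ : IsStoppingTime F fun ω => (τ ω : WithTop ℕ)) (j : ℕ) :
    AEStronglyMeasurable[F j] (fun ω => ind (j < τ ω)) μ := by
  refine (measurable_ind ?_).aestronglyMeasurable
  have h := (hτ j).compl
  convert h using 1
  ext ω
  simp

variable [IsProbabilityMeasure μ]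

/-- The conditional expectation of the increment of a stopped process in terms of its one-step
conditional increments. -/
theorem condExp_stopped_sub {τ : Ω → ℕ} {X : ℕ → Ω → ℝ} {k T : ℕ} (hkT : k ≤ T)
    (hX : ∀ j, k ≤ j → j ≤ T → Integrable (X j) μ)
    (hτ : ∀ j, k ≤ j → j < T → AEStronglyMeasurable[F j] (fun ω => ind (j < τ ω)) μ) :
    μ[fun ω => X (min T (τ ω)) ω - X (min k (τ ω)) ω | F k] =ᵐ[μ]
      ∑ j ∈ Ico k T, μ[fun ω => ind (j < τ ω) * (μ[X (j + 1) - X j | F j]) ω | F k] := by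
  have h1 : (fun ω => X (min T (τ ω)) ω - X (min k (τ ω)) ω) =
      ∑ j ∈ Ico k T, fun ω => ind (j < τ ω) * (X (j + 1) - X j) ω := by
    funext ω
    rw [Finset.sum_apply]
    exact stopped_sub_eq_sum (fun j => X j ω) (τ ω) hkT
  have hint : ∀ j ∈ Ico k T, Integrable (X (j + 1) - X j) μ := fun j hj => by
    rw [Finset.mem_Ico] at hj
    exact (hX _ (by omega) (by omega)).sub (hX _ hj.1 (by omega))
  rw [h1]
  refine (condExp_finsetSum (fun j hj => ?_) _).trans (eventuallyEq_sum fun j hj => ?_)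
  · have hj' := Finset.mem_Ico.1 hj
    exact integrable_ind_mul (F.le j) (hτ j hj'.1 hj'.2) (hint j hj)
  · have hj' := Finset.mem_Ico.1 hj
    refine (condExp_condExp_of_le (F.mono hj'.1) (F.le j)).symm.trans (condExp_congr_ae ?_)
    exact condExp_mul_of_aestronglyMeasurable_left (hτ j hj'.1 hj'.2)
      (integrable_ind_mul (F.le j) (hτ j hj'.1 hj'.2) (hint j hj)) (hint j hj)

variable {F} {c V : ℕ → Ω → ℝ} {k T : ℕ}

lemma sum_mul_ind_le {t : ℕ} (hT : t ≤ T) (c : ℕ → ℝ) :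
    ∑ l ∈ Ioc k T, c l * ind (l ≤ t) = ∑ l ∈ Ioc k t, c l := by
  rw [← Finset.sum_subset (Finset.Ioc_subset_Ioc_right hT) (f := fun l => c l * ind (l ≤ t))]
  · refine Finset.sum_congr rfl fun l hl => ?_
    rw [ind_of_true (Finset.mem_Ioc.1 hl).2, mul_one]
  · intro l hl hl'
    rw [Finset.mem_Ioc] at hl hl'
    rw [ind_of_false (by omega), mul_zero]

/-- The one-step conditional increments of the cumulated cash flows plus value. -/
lemma condExp_gain_increment (hc : ∀ j, Integrable (c j) μ)
    (hV : ∀ j, k ≤ j → j ≤ T → Integrable (V j) μ)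
    (hVm : ∀ j, k ≤ j → j ≤ T → StronglyMeasurable[F j] (V j)) {j : ℕ} (hkj : k ≤ j) (hj : j < T) :
    μ[(fun ω => ∑ l ∈ Ioc k (j + 1), c l ω + V (j + 1) ω)
      - (fun ω => ∑ l ∈ Ioc k j, c l ω + V j ω) | F j] =ᵐ[μ]
      μ[c (j + 1) + V (j + 1) | F j] - V j := by
  have h1 : (fun ω => ∑ l ∈ Ioc k (j + 1), c l ω + V (j + 1) ω)
      - (fun ω => ∑ l ∈ Ioc k j, c l ω + V j ω) = (c (j + 1) + V (j + 1)) - V j := by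
    funext ω
    simp only [Pi.sub_apply, Pi.add_apply]
    rw [← Finset.insert_Ioc_right_eq_Ioc_add_one hkj, Finset.sum_insert (by simp)]
    ring
  rw [h1]
  refine (condExp_sub ((hc _).add (hV _ (by omega) hj)) (hV j hkj hj.le) _).trans ?_
  rw [condExp_of_stronglyMeasurable (F.le j) (hVm j hkj hj.le) (hV j hkj hj.le)]

/-- The gains accumulated up to `τ` plus the residual value `V τ` form the process "past flows plus
value" stopped at `τ`. Its expected growth is the sum of the one-step defects of the dynamic
programming equation before `τ`. Both halves of the verification argument read off the sign of these
defects. -/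
lemma condExp_stoppedSum_add (hkT : k ≤ T) (hc : ∀ j, Integrable (c j) μ)
    (hV : ∀ j, k ≤ j → j ≤ T → Integrable (V j) μ)
    (hVm : ∀ j, k ≤ j → j ≤ T → StronglyMeasurable[F j] (V j))
    {τ : Ω → ℕ} (hτ : IsStoppingTime F fun ω => (τ ω : WithTop ℕ))
    (hτk : ∀ ω, k ≤ τ ω ∧ τ ω ≤ T) :
    μ[fun ω => ∑ l ∈ Ioc k T, c l ω * ind (l ≤ τ ω) + V (τ ω) ω | F k] =ᵐ[μ]
      V k + ∑ j ∈ Ico k T, μ[fun ω => ind (j < τ ω) *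
        ((μ[c (j + 1) + V (j + 1) | F j]) ω - V j ω) | F k] := by
  set X : ℕ → Ω → ℝ := fun j ω => ∑ l ∈ Ioc k j, c l ω + V j ω with hXdef
  have hX : ∀ j, k ≤ j → j ≤ T → Integrable (X j) μ := fun j h1 h2 =>
    (integrable_finsetSum _ fun l _ => hc l).add (hV j h1 h2)
  have key := condExp_stopped_sub F hkT hX fun j _ _ =>
    IsStoppingTime.aestronglyMeasurable_ind_lt (μ := μ) hτ j
  have h1 : (fun ω => ∑ l ∈ Ioc k T, c l ω * ind (l ≤ τ ω) + V (τ ω) ω) =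
      V k + fun ω => X (min T (τ ω)) ω - X (min k (τ ω)) ω := by
    funext ω
    rw [sum_mul_ind_le (hτk ω).2 fun l => c l ω]
    simp only [Pi.add_apply]
    rw [min_eq_right (hτk ω).2, min_eq_left (hτk ω).1]
    simp [hXdef]
  have hint : Integrable (fun ω => X (min T (τ ω)) ω - X (min k (τ ω)) ω) μ := by
    have : (fun ω => X (min T (τ ω)) ω - X (min k (τ ω)) ω) =
        fun ω => ∑ j ∈ Ico k T, ind (j < τ ω) * (X (j + 1) - X j) ω := by
      funext ω
      exact stopped_sub_eq_sum (fun j => X j ω) (τ ω) hkT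
    rw [this]
    refine integrable_finsetSum _ fun j hj => ?_
    rw [Finset.mem_Ico] at hj
    exact integrable_ind_mul (F.le j) (IsStoppingTime.aestronglyMeasurable_ind_lt hτ j)
      ((hX _ (by omega) (by omega)).sub (hX _ hj.1 (by omega)))
  rw [h1]
  refine (condExp_add (hV k le_rfl hkT) hint _).trans ?_
  rw [condExp_of_stronglyMeasurable (F.le k) (hVm k le_rfl hkT) (hV k le_rfl hkT)]
  refine Filter.EventuallyEq.add Filter.EventuallyEq.rfl (key.trans ?_)
  refine eventuallyEq_sum fun j hj => condExp_congr_ae ?_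
  rw [Finset.mem_Ico] at hj
  filter_upwards [condExp_gain_increment hc hV hVm hj.1 hj.2] with ω h
  rw [h]
  rfl

/-- A nonnegative supersolution of the dynamic programming equation dominates the values of all
exercise rules. -/
theorem condExp_stoppedSum_le (hkT : k ≤ T) (hc : ∀ j, Integrable (c j) μ)
    (hV : ∀ j, k ≤ j → j ≤ T → Integrable (V j) μ)
    (hVm : ∀ j, k ≤ j → j ≤ T → StronglyMeasurable[F j] (V j))
    (hV0 : ∀ j, k ≤ j → j ≤ T → ∀ ω, 0 ≤ V j ω)
    (hstep : ∀ j, k ≤ j → j < T → μ[c (j + 1) + V (j + 1) | F j] ≤ᵐ[μ] V j)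
    {τ : Ω → ℕ} (hτ : IsStoppingTime F fun ω => (τ ω : WithTop ℕ))
    (hτk : ∀ ω, k ≤ τ ω ∧ τ ω ≤ T) :
    μ[fun ω => ∑ l ∈ Ioc k T, c l ω * ind (l ≤ τ ω) | F k] ≤ᵐ[μ] V k := by
  have hτm : Measurable τ := by
    refine measurable_of_Iic fun j => F.le j _ ?_
    convert hτ j using 1
    ext ω
    simp
  have hi1 : Integrable (fun ω => ∑ l ∈ Ioc k T, c l ω * ind (l ≤ τ ω)) μ := by
    refine integrable_finsetSum _ fun l _ => ?_
    simp_rw [mul_comm (c l _)]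
    exact integrable_ind_mul le_rfl
      (measurable_ind (hτm measurableSet_Ici)).aestronglyMeasurable (hc l)
  -- `V τ` is a finite combination of the variables `V j`, as `τ` takes finitely many values.
  have hi2 : Integrable (fun ω => V (τ ω) ω) μ := by
    have h : (fun ω => V (τ ω) ω) = fun ω => ∑ j ∈ Icc k T, ind (τ ω = j) * V j ω := by
      funext ω
      rw [Finset.sum_eq_single (τ ω)]
      · simp [ind_of_true]
      · intro j _ hj
        rw [ind_of_false (Ne.symm hj), zero_mul]
      · intro h
        exact absurd (Finset.mem_Icc.2 (hτk ω)) h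
    rw [h]
    refine integrable_finsetSum _ fun j hj => ?_
    rw [Finset.mem_Icc] at hj
    exact integrable_ind_mul le_rfl
      (measurable_ind (hτm (measurableSet_singleton j))).aestronglyMeasurable (hV j hj.1 hj.2)
  have h1 : μ[fun ω => ∑ l ∈ Ioc k T, c l ω * ind (l ≤ τ ω) | F k] ≤ᵐ[μ]
      μ[fun ω => ∑ l ∈ Ioc k T, c l ω * ind (l ≤ τ ω) + V (τ ω) ω | F k] := by
    refine condExp_mono hi1 (hi1.add hi2) (Filter.Eventually.of_forall fun ω => ?_)
    have := hV0 (τ ω) (hτk ω).1 (hτk ω).2 ω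
    simpa using this
  have h2 : ∀ j ∈ Ico k T, μ[fun ω => ind (j < τ ω) *
        ((μ[c (j + 1) + V (j + 1) | F j]) ω - V j ω) | F k] ≤ᵐ[μ] 0 := fun j hj => by
    rw [Finset.mem_Ico] at hj
    have h3 : 0 ≤ᵐ[μ] μ[fun ω => -(ind (j < τ ω) *
        ((μ[c (j + 1) + V (j + 1) | F j]) ω - V j ω)) | F k] := by
      refine condExp_nonneg ?_
      filter_upwards [hstep j hj.1 hj.2] with ω hω
      have := mul_nonneg (ind_nonneg (j < τ ω)) (sub_nonneg.2 hω)
      simp only [Pi.zero_apply]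
      linarith
    have h4 := condExp_neg (μ := μ) (fun ω => ind (j < τ ω) *
        ((μ[c (j + 1) + V (j + 1) | F j]) ω - V j ω)) (F k)
    filter_upwards [h3, h4] with ω h3 h4
    simp only [Pi.zero_apply, Pi.neg_apply] at *
    have h5 : (-fun ω => ind (j < τ ω) * ((μ[c (j + 1) + V (j + 1) | F j]) ω - V j ω)) =
      fun ω => -(ind (j < τ ω) * ((μ[c (j + 1) + V (j + 1) | F j]) ω - V j ω)) := rfl
    rw [h5] at h4
    linarith
  have h3 := (Filter.eventually_all_finset (l := ae μ) (Ico k T)).2 h2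
  filter_upwards [h1, condExp_stoppedSum_add hkT hc hV hVm hτ hτk, h3] with ω h1 h2 h3
  refine h1.trans ?_
  rw [h2, Pi.add_apply, Finset.sum_apply]
  have := Finset.sum_nonpos h3
  linarith

/-- A solution of the dynamic programming equation is the value of an exercise rule. -/
theorem exists_condExp_stoppedSum_eq (hkT : k ≤ T) (hc : ∀ j, Integrable (c j) μ)
    (hV : ∀ j, k ≤ j → j ≤ T → Integrable (V j) μ)
    (hVm : ∀ j, k ≤ j → j ≤ T → StronglyMeasurable[F j] (V j))
    (hVT : ∀ ω, V T ω = 0)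
    (hstep : ∀ j, k ≤ j → j < T → ∀ᵐ ω ∂μ, V j ω ≠ 0 →
      (μ[c (j + 1) + V (j + 1) | F j]) ω = V j ω) :
    ∃ τ : Ω → ℕ, IsStoppingTime F (fun ω => (τ ω : WithTop ℕ)) ∧ (∀ ω, k ≤ τ ω ∧ τ ω ≤ T) ∧
      μ[fun ω => ∑ l ∈ Ioc k T, c l ω * ind (l ≤ τ ω) | F k] =ᵐ[μ] V k := by
  have hne : ∀ ω, {j | k ≤ j ∧ V j ω = 0}.Nonempty := fun ω => ⟨T, hkT, hVT ω⟩
  -- The optimal rule stops when the value first vanishes. The residual `V τ` is then zero, and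
  -- before `τ` the value is nonzero, so the dynamic programming equation holds with equality and
  -- all defects disappear.
  set τ : Ω → ℕ := fun ω => sInf {j | k ≤ j ∧ V j ω = 0} with hτdef
  have hmem : ∀ ω, k ≤ τ ω ∧ V (τ ω) ω = 0 := fun ω => Nat.sInf_mem (hne ω)
  have hτT : ∀ ω, τ ω ≤ T := fun ω => Nat.sInf_le ⟨hkT, hVT ω⟩
  have hτ : IsStoppingTime F fun ω => (τ ω : WithTop ℕ) := by
    intro i
    have h : {ω | (τ ω : WithTop ℕ) ≤ i} =
        ⋃ j ∈ Icc k (min i T), {ω | V j ω = 0} := by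
      ext ω
      simp only [Set.mem_ofPred_eq, Nat.cast_le, Set.mem_iUnion, Finset.mem_Icc, exists_prop]
      constructor
      · intro h
        exact ⟨τ ω, ⟨(hmem ω).1, le_min (by exact_mod_cast h) (hτT ω)⟩, (hmem ω).2⟩
      · rintro ⟨j, hj, h⟩
        have : τ ω ≤ j := Nat.sInf_le ⟨hj.1, h⟩
        exact_mod_cast this.trans (hj.2.trans (min_le_left _ _))
    change MeasurableSet[F i] {ω | (τ ω : WithTop ℕ) ≤ i}
    rw [h]
    -- The union runs only up to `min i T`: adaptedness of `V` is available up to `T`, and `τ ≤ T`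
    -- makes later dates superfluous.
    refine Finset.measurableSet_biUnion _ fun j hj => ?_
    rw [Finset.mem_Icc, le_min_iff] at hj
    exact F.mono hj.2.1 _
      ((hVm j hj.1 hj.2.2).measurable (measurableSet_singleton 0))
  refine ⟨τ, hτ, fun ω => ⟨(hmem ω).1, hτT ω⟩, ?_⟩
  have h1 := condExp_stoppedSum_add hkT hc hV hVm hτ fun ω => ⟨(hmem ω).1, hτT ω⟩
  simp only [(hmem _).2, add_zero] at h1
  have h2 : ∀ j ∈ Ico k T, μ[fun ω => ind (j < τ ω) *
        ((μ[c (j + 1) + V (j + 1) | F j]) ω - V j ω) | F k] =ᵐ[μ] 0 := fun j hj => by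
    rw [Finset.mem_Ico] at hj
    rw [← condExp_zero (μ := μ) (m := F k)]
    refine condExp_congr_ae ?_
    filter_upwards [hstep j hj.1 hj.2] with ω hω
    by_cases h : j < τ ω
    · have : V j ω ≠ 0 := fun h0 => Nat.notMem_of_lt_sInf h ⟨hj.1, h0⟩
      rw [hω this, sub_self, mul_zero]
      rfl
    · rw [ind_of_false h, zero_mul]
      rfl
  have h3 := (Filter.eventually_all_finset (l := ae μ) (Ico k T)).2 h2
  filter_upwards [h1, h3] with ω h1 h3
  rw [h1, Pi.add_apply, Finset.sum_apply, Finset.sum_eq_zero h3, add_zero]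

end Stopping

/-- Conditional expectation of the product of a measurable and an independent factor. -/
lemma condExp_mul_of_indep {Ω : Type*} {m₁ m mΩ : MeasurableSpace Ω} {μ : Measure Ω}
    [IsProbabilityMeasure μ] (hm₁ : m₁ ≤ mΩ) (hm : m ≤ mΩ) {Z d : Ω → ℝ}
    (hZ : AEStronglyMeasurable[m] Z μ) (hd : StronglyMeasurable[m₁] d)
    (hdi : Integrable d μ) (hZd : Integrable (fun ω => Z ω * d ω) μ) (hind : Indep m₁ m μ) :
    μ[fun ω => Z ω * d ω | m] =ᵐ[μ] fun ω => Z ω * ∫ ω', d ω' ∂μ := by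
  refine (condExp_mul_of_aestronglyMeasurable_left hZ hZd hdi).trans ?_
  filter_upwards [condExp_indep_eq hm₁ hm hd hind] with ω hω
  rw [Pi.mul_apply, hω]

lemma integrable_of_abs_le {Ω : Type*} {mΩ : MeasurableSpace Ω} {μ : Measure Ω}
    [IsFiniteMeasure μ] {f : Ω → ℝ} (hf : AEStronglyMeasurable f μ) (C : ℝ)
    (h : ∀ ω, |f ω| ≤ C) : Integrable f μ :=
  Integrable.of_bound hf C (Filter.Eventually.of_forall fun ω => by simpa using h ω)

/-! ### The trader's model -/

instance (ν : ℕ → ℝ) : IsProbabilityMeasure (traderLaw ν) := by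
  unfold traderLaw
  infer_instance

/-- The indicator that the trader's Poisson process has not jumped yet. -/
noncomputable def survival (k l : ℕ) (x : ℕ → ℕ) : ℝ := ind (traderCount k l x = 0)

lemma survival_self (k : ℕ) (x : ℕ → ℕ) : survival k k x = 1 :=
  ind_of_true (by simp [traderCount])

lemma survival_eq_one_or (k l : ℕ) (x : ℕ → ℕ) : survival k l x = 1 ∨ survival k l x = 0 := by
  by_cases h : traderCount k l x = 0
  · exact Or.inl (ind_of_true h)
  · exact Or.inr (ind_of_false h)

lemma abs_survival_le (k l : ℕ) (x : ℕ → ℕ) : |survival k l x| ≤ 1 := by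
  rcases survival_eq_one_or k l x with h | h <;> simp [h]

lemma survival_succ {k l : ℕ} (h : k ≤ l) (x : ℕ → ℕ) :
    survival k (l + 1) x = survival k l x * ind (x l = 0) := by
  have h1 : traderCount k (l + 1) x = traderCount k l x + x l := Finset.sum_Ico_succ_top h _
  unfold survival
  rw [h1]
  by_cases h2 : traderCount k l x = 0 <;> by_cases h3 : x l = 0 <;>
    simp [ind_of_true, ind_of_false, h2, h3]

lemma stronglyMeasurable_survival (k l : ℕ) :
    StronglyMeasurable[traderFiltration k l] (survival k l) := by
  have h : StronglyMeasurable[traderFiltration k l] (traderCount k l) :=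
    Filtration.stronglyAdapted_natural
      (fun l => (Finset.measurable_sum _ fun j _ => measurable_pi_apply j).stronglyMeasurable) l
  exact (measurable_ind (h.measurable (measurableSet_singleton 0))).stronglyMeasurable

lemma measurable_comap_restrict {ι Ω β : Type*} [MeasurableSpace β] (f : ι → Ω → β)
    {S : Finset ι} {i : ι} (hi : i ∈ S) :
    Measurable[MeasurableSpace.comap (fun ω (j : S) => f j ω) MeasurableSpace.pi] (f i) :=
  (measurable_pi_apply (X := fun _ : S => β) (⟨i, hi⟩ : S)).comp
    (comap_measurable fun ω (j : S) => f j ω)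

/-- The counts up to time `l` are sums of coordinates with index below `l`, so they are independent
of the coordinate `l`. -/
lemma indep_eval_traderFiltration (ν : ℕ → ℝ) (k l : ℕ) :
    Indep (MeasurableSpace.comap (fun x : ℕ → ℕ => x l) inferInstance) (traderFiltration k l)
      (traderLaw ν) := by
  have h1 : iIndepFun (fun (i : ℕ) (x : ℕ → ℕ) => x i) (traderLaw ν) :=
    iIndepFun_infinitePi (X := fun _ n => n) fun _ => measurable_id
  have h2 := h1.indepFun_finset {l} (range l) (by simp) fun i => measurable_pi_apply i
  refine indep_of_indep_of_le_left (indep_of_indep_of_le_right h2 ?_) ?_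
  · refine iSup₂_le fun j hj => ?_
    rw [← measurable_iff_comap_le]
    exact Finset.measurable_sum _ fun i hi => measurable_comap_restrict
      (fun i (x : ℕ → ℕ) => x i) (by rw [Finset.mem_Ico] at hi; simp; omega)
  · rw [← measurable_iff_comap_le]
    exact measurable_comap_restrict (fun i (x : ℕ → ℕ) => x i) (Finset.mem_singleton_self l)

lemma integral_ind_eval (ν : ℕ → ℝ) {l : ℕ} (h : 0 ≤ ν l) :
    ∫ x, ind (x l = 0) ∂(traderLaw ν) = Real.exp (-ν l) := by
  have h1 : ∫ x, ind (x l = 0) ∂(traderLaw ν) =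
      ∫ n, ind (n = 0) ∂(poissonMeasure (ν l).toNNReal) := by
    rw [← Measure.infinitePi_map_eval (fun l => poissonMeasure (ν l).toNNReal) l,
      integral_map (measurable_pi_apply l).aemeasurable
        (measurable_of_countable _).aestronglyMeasurable]
    rfl
  rw [h1, integral_poissonMeasure, tsum_eq_single 0]
  · simp [ind_of_true, h]
  · intro n hn
    simp [ind_of_false hn]

variable {ν : ℕ → ℝ}

lemma integrable_survival (k l : ℕ) : Integrable (survival k l) (traderLaw ν) :=
  integrable_of_abs_le
    ((stronglyMeasurable_survival k l).mono ((traderFiltration k).le l)).aestronglyMeasurable 1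
    (abs_survival_le k l)

/-- Surviving one more period means having survived so far and seeing no jump in an independent
Poisson variable. -/
lemma condExp_survival {k l : ℕ} (h : k ≤ l) (hν : 0 ≤ ν l) :
    (traderLaw ν)[survival k (l + 1) | traderFiltration k l] =ᵐ[traderLaw ν]
      fun x => survival k l x * Real.exp (-ν l) := by
  have h1 : survival k (l + 1) = fun x => survival k l x * ind (x l = 0) :=
    funext (survival_succ h)
  have h2 := integrable_survival (ν := ν) k (l + 1)
  rw [h1] at h2 ⊢
  rw [← integral_ind_eval ν hν]
  have h3 : StronglyMeasurable[MeasurableSpace.comap (fun x : ℕ → ℕ => x l) inferInstance]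
      fun x : ℕ → ℕ => ind (x l = 0) :=
    (measurable_ind (p := fun x : ℕ → ℕ => x l = 0)
      (MeasurableSpace.measurableSet_comap.2 ⟨{0}, measurableSet_singleton 0, rfl⟩)).stronglyMeasurable
  have h4 : MeasurableSpace.comap (fun x : ℕ → ℕ => x l) inferInstance ≤ MeasurableSpace.pi :=
    (measurable_pi_apply l).comap_le
  refine condExp_mul_of_indep h4 ((traderFiltration k).le l)
    (stronglyMeasurable_survival k l).aestronglyMeasurable h3 ?_ h2
    (indep_eval_traderFiltration ν k l)
  exact integrable_of_abs_le (h3.mono h4).aestronglyMeasurable 1 fun x => by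
    rw [abs_of_nonneg (ind_nonneg _)]
    exact ind_le_one _

lemma integral_survival {k l : ℕ} (h : k ≤ l) (hν : ∀ j, k ≤ j → j < l → 0 ≤ ν j) :
    ∫ x, survival k l x ∂(traderLaw ν) = Real.exp (-∑ j ∈ Ico k l, ν j) := by
  induction l, h using Nat.le_induction with
  | base => simp [survival_self]
  | succ l hl ih =>
    rw [← integral_condExp ((traderFiltration k).le l),
      integral_congr_ae (condExp_survival hl (hν l hl (by omega))), integral_mul_const,
      ih fun j h1 h2 => hν j h1 (by omega), Finset.sum_Ico_succ_top hl, ← Real.exp_add]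
    congr 1
    ring

lemma ind_traderRegime_neg (k l : ℕ) (x : ℕ → ℕ) :
    ind (traderRegime k 1 l x = -1) = 1 - survival k l x := by
  unfold survival traderRegime
  by_cases h : traderCount k l x = 0 <;> simp [h, ind_of_true, ind_of_false]

lemma ind_traderRegime_one (k l : ℕ) (x : ℕ → ℕ) :
    ind (traderRegime k 1 l x = 1) = survival k l x := by
  unfold survival traderRegime
  by_cases h : traderCount k l x = 0 <;> simp [h, ind_of_true, ind_of_false]

lemma traderDP_neg (T : ℕ) (ν : ℕ → ℝ) (n : ℕ) : traderDP T ν n (-1) = n := by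
  cases n <;> simp [traderDP]

lemma traderDP_one_succ (T : ℕ) (ν : ℕ → ℝ) (n : ℕ) :
    traderDP T ν (n + 1) 1 = max 0 (Real.exp (-ν (T - (n + 1))) * (-1 + traderDP T ν n 1)
        + (1 - Real.exp (-ν (T - (n + 1)))) * (1 + n)) := by
  simp [traderDP, traderDP_neg]

lemma traderDP_one_nonneg (T : ℕ) (ν : ℕ → ℝ) (n : ℕ) : 0 ≤ traderDP T ν n 1 := by
  cases n with
  | zero => simp [traderDP]
  | succ n => rw [traderDP_one_succ]; exact le_max_left _ _

/-- The recursion reads the intensities only between the current date and maturity. Calibration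
therefore needs to agree with the explicit curve only up to `T`, where the law of `N` is prescribed.
-/
lemma traderDP_congr {T n : ℕ} {ν ν' : ℕ → ℝ} (hn : n ≤ T)
    (h : ∀ l, T - n ≤ l → l < T → ν l = ν' l) : traderDP T ν n 1 = traderDP T ν' n 1 := by
  induction n with
  | zero => simp [traderDP]
  | succ n ih =>
    rw [traderDP_one_succ, traderDP_one_succ, h _ le_rfl (by omega),
      ih (by omega) fun l h1 h2 => h l (by omega) h2]

/-- The value process of the trader's model. -/
noncomputable def traderProcess (ν : ℕ → ℝ) (T k l : ℕ) (x : ℕ → ℕ) : ℝ :=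
  survival k l x * traderDP T ν (T - l) 1 + (1 - survival k l x) * (T - l : ℕ)

/-- The cash flow process of the trader's model. -/
noncomputable def traderFlow (k l : ℕ) (x : ℕ → ℕ) : ℝ := 1 - 2 * survival k l x

lemma stronglyMeasurable_traderProcess (ν : ℕ → ℝ) (T k l : ℕ) :
    StronglyMeasurable[traderFiltration k l] (traderProcess ν T k l) :=
  ((stronglyMeasurable_survival k l).mul_const _).add
    ((stronglyMeasurable_const.sub (stronglyMeasurable_survival k l)).mul_const _)

lemma integrable_traderProcess (ν' : ℕ → ℝ) (T k l : ℕ) :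
    Integrable (traderProcess ν' T k l) (traderLaw ν) :=
  ((integrable_survival k l).mul_const _).add
    (((integrable_const _).sub (integrable_survival k l)).mul_const _)

lemma integrable_traderFlow (k l : ℕ) : Integrable (traderFlow k l) (traderLaw ν) :=
  (integrable_const _).sub ((integrable_survival k l).const_mul _)

lemma traderProcess_nonneg (ν : ℕ → ℝ) (T k l : ℕ) (x : ℕ → ℕ) : 0 ≤ traderProcess ν T k l x := by
  unfold traderProcess
  rcases survival_eq_one_or k l x with h | h
  · simpa [h] using traderDP_one_nonneg T ν (T - l)
  · simp [h]

/-- Next flow plus next value is affine in the survival indicator, since an absorbed path pays `1`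
at each remaining date. `condExp_survival` then gives the continuation value. -/
lemma condExp_traderFlow_add {k l T : ℕ} (h : k ≤ l) (hl : l < T) (hν : 0 ≤ ν l) :
    (traderLaw ν)[traderFlow k (l + 1) + traderProcess ν T k (l + 1) | traderFiltration k l]
      =ᵐ[traderLaw ν] fun x => survival k l x *
        (Real.exp (-ν l) * (-1 + traderDP T ν (T - (l + 1)) 1)
          + (1 - Real.exp (-ν l)) * (1 + (T - (l + 1) : ℕ)))
        + (1 - survival k l x) * (T - l : ℕ) := by
  obtain ⟨n, rfl⟩ : ∃ n, T = l + 1 + n := ⟨T - (l + 1), by omega⟩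
  have e1 : l + 1 + n - (l + 1) = n := by omega
  have e2 : l + 1 + n - l = n + 1 := by omega
  rw [e1, e2]
  set D := traderDP (l + 1 + n) ν n 1 with hD
  have h1 : traderFlow k (l + 1) + traderProcess ν (l + 1 + n) k (l + 1) =
      (fun _ => (1 + n : ℝ)) + (D - n - 2) • survival k (l + 1) := by
    funext x
    simp only [Pi.add_apply, traderFlow, traderProcess, Pi.smul_apply, smul_eq_mul, e1, ← hD]
    ring
  rw [h1]
  have h2 := condExp_add (integrable_const (1 + n : ℝ))
    ((integrable_survival (ν := ν) k (l + 1)).smul (D - n - 2)) (traderFiltration k l)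
  have h3 := condExp_smul (μ := traderLaw ν) (D - n - 2) (survival k (l + 1))
    (traderFiltration k l)
  filter_upwards [h2, h3, condExp_survival h hν] with x h2 h3 h4
  rw [h2, Pi.add_apply, h3, condExp_const ((traderFiltration k).le l), Pi.smul_apply, h4]
  simp only [smul_eq_mul]
  push_cast
  ring

lemma traderReward_eq {p : ℕ → ℝ} {k T : ℕ} (θ : (ℕ → ℕ) → ℕ) :
    traderReward p k T 1 θ =
      ∫ x, ∑ ℓ ∈ Ioc k T, traderFlow k ℓ x * ind (ℓ ≤ θ x) ∂(traderLaw (calibRate p k)) := by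
  unfold traderReward traderFlow
  congr 1
  funext x
  refine Finset.sum_congr rfl fun l _ => ?_
  rw [ind_traderRegime_neg, ind_traderRegime_one]
  ring

lemma integral_traderProcess (T k : ℕ) :
    ∫ x, traderProcess ν T k k x ∂(traderLaw ν) = traderDP T ν (T - k) 1 := by
  simp [traderProcess, survival_self]

/-- Verification argument with `traderProcess` as value. Before the jump the one-step equation is
the recursion with its maximum; after it, the equation is the identity "remaining dates = one +
remaining dates after the next". Having a greatest element, not just a bound, makes the real `sSup`
in `traderValue` meaningful. -/
theorem isGreatest_traderReward {p : ℕ → ℝ} {k T : ℕ} (hkT : k ≤ T)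
    (hν : ∀ l, k ≤ l → l < T → 0 ≤ calibRate p k l) :
    IsGreatest {v | ∃ θ, IsTraderRule k T θ ∧ v = traderReward p k T 1 θ}
      (traderDP T (calibRate p k) (T - k) 1) := by
  set ν := calibRate p k with hνdef
  have hdp : ∀ l, k ≤ l → l < T → traderDP T ν (T - l) 1 =
      max 0 (Real.exp (-ν l) * (-1 + traderDP T ν (T - (l + 1)) 1)
        + (1 - Real.exp (-ν l)) * (1 + (T - (l + 1) : ℕ))) := fun l _ h2 => by
    have e : T - l = (T - (l + 1)) + 1 := by omega
    rw [e, traderDP_one_succ]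
    have e' : T - (T - (l + 1) + 1) = l := by omega
    rw [e']
  constructor
  · obtain ⟨τ, hτ, hτk, h⟩ := exists_condExp_stoppedSum_eq (μ := traderLaw ν)
      (F := traderFiltration k) (c := traderFlow k) (V := traderProcess ν T k) hkT
      (integrable_traderFlow k) (fun j _ _ => integrable_traderProcess ν T k j)
      (fun j _ _ => stronglyMeasurable_traderProcess ν T k j)
      (fun x => by simp [traderProcess, traderDP]) (fun l h1 h2 => by
        filter_upwards [condExp_traderFlow_add h1 h2 (hν l h1 h2)] with x hx
        intro hne
        rw [hx]
        unfold traderProcess at hne ⊢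
        rcases survival_eq_one_or k l x with h | h
        · rw [h, hdp l h1 h2] at hne ⊢
          simp only [one_mul, sub_self, zero_mul, add_zero] at hne ⊢
          rcases max_choice 0 (Real.exp (-ν l) * (-1 + traderDP T ν (T - (l + 1)) 1)
            + (1 - Real.exp (-ν l)) * (1 + (T - (l + 1) : ℕ))) with h | h
          · exact absurd h hne
          · exact h.symm
        · simp [h])
    refine ⟨τ, ⟨hτ, hτk⟩, ?_⟩
    rw [traderReward_eq, ← integral_traderProcess, ← integral_congr_ae h,
      integral_condExp ((traderFiltration k).le k)]
  · rintro v ⟨θ, ⟨hθ, hθk⟩, rfl⟩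
    have h := condExp_stoppedSum_le (μ := traderLaw ν)
      (F := traderFiltration k) (c := traderFlow k) (V := traderProcess ν T k) hkT
      (integrable_traderFlow k) (fun j _ _ => integrable_traderProcess ν T k j)
      (fun j _ _ => stronglyMeasurable_traderProcess ν T k j)
      (fun j _ _ => traderProcess_nonneg ν T k j) (fun l h1 h2 => by
        filter_upwards [condExp_traderFlow_add h1 h2 (hν l h1 h2)] with x hx
        rw [hx]
        unfold traderProcess
        rcases survival_eq_one_or k l x with h | h
        · rw [h, hdp l h1 h2]
          simp
        · simp [h]) hθ hθk
    rw [traderReward_eq, ← integral_traderProcess, ← integral_condExp ((traderFiltration k).le k)]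
    exact integral_mono_ae integrable_condExp (integrable_traderProcess ν T k k) h

theorem traderValue_eq {p : ℕ → ℝ} {k T : ℕ} (hkT : k ≤ T)
    (hν : ∀ l, k ≤ l → l < T → 0 ≤ calibRate p k l) :
    traderValue p k T 1 = traderDP T (calibRate p k) (T - k) 1 :=
  (isGreatest_traderReward hkT hν).csSup_eq

lemma traderReward_of_isOptimal {p : ℕ → ℝ} {k T : ℕ} {s : ℤ} {θ : (ℕ → ℕ) → ℕ}
    (hθ : IsOptimalTraderRule p k T s θ) : traderReward p k T s θ = traderValue p k T s :=
  (IsGreatest.csSup_eq (s := {v | ∃ θ, IsTraderRule k T θ ∧ v = traderReward p k T s θ})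
    ⟨⟨θ, hθ.1, rfl⟩, by rintro v ⟨θ', h, rfl⟩; exact hθ.2 θ' h⟩).symm

lemma measurable_of_isTraderRule {k T : ℕ} {θ : (ℕ → ℕ) → ℕ} (hθ : IsTraderRule k T θ) :
    Measurable θ := by
  refine measurable_of_Iic fun j => (traderFiltration k).le j _ ?_
  convert hθ.1 j using 1
  ext ω
  simp

/-! ### The market -/

/-- The assumptions on the Poisson-type process `N`. -/
structure IsMarket {Ω : Type*} {mΩ : MeasurableSpace Ω} (μ : Measure Ω) (T : ℕ) (γ : ℕ → ℝ≥0)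
    (N : ℕ → Ω → ℕ) : Prop where
  measurable : ∀ k, Measurable (N k)
  zero : ∀ ω, N 0 ω = 0
  law : ∀ l < T, μ.map (fun ω => (N (l + 1) ω : ℤ) - (N l ω : ℤ)) =
    (poissonMeasure (γ l)).map (fun n : ℕ => (n : ℤ))
  indep : iIndepFun (fun (l : Fin T) ω => (N ((l : ℕ) + 1) ω : ℤ) - (N l ω : ℤ)) μ

/-- The regime as a real number. -/
noncomputable def sgn {Ω : Type*} (N : ℕ → Ω → ℕ) (k : ℕ) (ω : Ω) : ℝ := (-1) ^ N k ω

section Regime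

variable {Ω : Type*} (N : ℕ → Ω → ℕ)

lemma regime_eq_or (k : ℕ) (ω : Ω) : regime N k ω = 1 ∨ regime N k ω = -1 :=
  neg_one_pow_eq_or ℤ _

lemma sgn_eq_cast (k : ℕ) (ω : Ω) : sgn N k ω = (regime N k ω : ℝ) := by
  simp [sgn, regime]

lemma sgn_eq_or (k : ℕ) (ω : Ω) : sgn N k ω = 1 ∨ sgn N k ω = -1 :=
  neg_one_pow_eq_or ℝ _

lemma abs_sgn_le (k : ℕ) (ω : Ω) : |sgn N k ω| ≤ 1 := by
  rcases sgn_eq_or N k ω with h | h <;> simp [h]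

/-- Reduces the pricing of an arbitrary function of the regime to that of its sign. -/
lemma apply_regime (f : ℤ → ℝ) (k : ℕ) (ω : Ω) :
    f (regime N k ω) = (f 1 + f (-1)) / 2 + (f 1 - f (-1)) / 2 * sgn N k ω := by
  rw [sgn_eq_cast]
  rcases regime_eq_or N k ω with h | h <;> rw [h] <;> push_cast <;> ring

lemma ind_regime_neg (k : ℕ) (ω : Ω) : ind (regime N k ω = -1) = (1 - sgn N k ω) / 2 := by
  rw [sgn_eq_cast]
  rcases regime_eq_or N k ω with h | h
  · rw [h, ind_of_false (by norm_num)]; norm_num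
  · rw [h, ind_of_true rfl]; norm_num

lemma ind_regime_one (k : ℕ) (ω : Ω) : ind (regime N k ω = 1) = (1 + sgn N k ω) / 2 := by
  rw [sgn_eq_cast]
  rcases regime_eq_or N k ω with h | h
  · rw [h, ind_of_true rfl]; norm_num
  · rw [h, ind_of_false (by norm_num)]; norm_num

lemma binaryVal_regime (γ : ℕ → ℝ≥0) (k ℓ j : ℕ) (ω : Ω) : binaryVal γ k ℓ (regime N j ω) =
    (1 - sgn N j ω * Real.exp (-2 * ∑ i ∈ Ico k ℓ, (γ i : ℝ))) / 2 := by
  rw [sgn_eq_cast]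
  unfold binaryVal
  rcases regime_eq_or N j ω with h | h
  · simp [h]
  · simp [h]

end Regime

/-- The generating function of the Poisson law at `-1`: the series sums to `exp (-g)`, and the
weight contributes a second factor `exp (-g)`. -/
lemma integral_neg_one_pow_poisson (g : ℝ≥0) :
    ∫ n, (-1 : ℝ) ^ n ∂(poissonMeasure g) = Real.exp (-2 * g) := by
  rw [integral_poissonMeasure]
  have h := (NormedSpace.expSeries_div_hasSum_exp (-(g : ℝ))).mul_left (Real.exp (-g))
  rw [← Real.exp_eq_exp_ℝ, ← Real.exp_add] at h
  rw [show (-2 * g : ℝ) = -g + -g by ring, ← h.tsum_eq]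
  refine tsum_congr fun n => ?_
  rw [smul_eq_mul, neg_pow (g : ℝ)]
  ring

section Market

variable {Ω : Type*} {mΩ : MeasurableSpace Ω} {μ : Measure Ω} {T : ℕ} {γ : ℕ → ℝ≥0}
  {N : ℕ → Ω → ℕ}

lemma measurableSet_filt_iff {k : ℕ} {s : Set Ω} : MeasurableSet[filt μ N k] s ↔
    (∃ t, MeasurableSet[⨆ j ≤ k, MeasurableSpace.comap (N j) ⊤] t ∧ s =ᵐ[μ] t) ∧
      MeasurableSet s :=
  MeasurableSpace.measurableSet_inf

namespace IsMarket

variable (hM : IsMarket μ T γ N)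

include hM

lemma measurable_filt {j k : ℕ} (h : j ≤ k) : Measurable[filt μ N k] (N j) := by
  intro s hs
  refine measurableSet_filt_iff.2 ⟨⟨_, ?_, Filter.EventuallyEq.rfl⟩, hM.measurable j hs⟩
  exact (le_iSup₂_of_le (f := fun j (_ : j ≤ k) => MeasurableSpace.comap (N j) ⊤) j h le_rfl) _
    ⟨s, trivial, rfl⟩

lemma measurable_sgn_filt {j k : ℕ} (h : j ≤ k) : Measurable[filt μ N k] (sgn N j) :=
  (measurable_of_countable fun n : ℕ => (-1 : ℝ) ^ n).comp (hM.measurable_filt h)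

lemma measurable_sgn (j : ℕ) : Measurable (sgn N j) :=
  (measurable_of_countable fun n : ℕ => (-1 : ℝ) ^ n).comp (hM.measurable j)

lemma measurable_regime_filt {j k : ℕ} (h : j ≤ k) : Measurable[filt μ N k] (regime N j) :=
  (measurable_of_countable fun n : ℕ => (-1 : ℤ) ^ n).comp (hM.measurable_filt h)

lemma stronglyMeasurable_apply_regime (f : ℤ → ℝ) (k : ℕ) :
    StronglyMeasurable[filt μ N k] fun ω => f (regime N k ω) :=
  ((measurable_of_countable f).comp (hM.measurable_regime_filt le_rfl)).stronglyMeasurable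

lemma measurable_regime (j : ℕ) : Measurable (regime N j) :=
  (measurable_of_countable fun n : ℕ => (-1 : ℤ) ^ n).comp (hM.measurable j)

lemma regime_zero (ω : Ω) : regime N 0 ω = 1 := by simp [regime, hM.zero]

lemma measurable_increment (j : ℕ) : Measurable fun ω => (N (j + 1) ω : ℤ) - (N j ω : ℤ) :=
  (measurable_from_nat.comp (hM.measurable _)).sub (measurable_from_nat.comp (hM.measurable _))

/-- As `N 0 = 0`, each `N i` with `i ≤ j` is a sum of increments of index below `j`. Augmentation
changes events only by null sets and so preserves independence. -/
lemma indep_increment {j : ℕ} (hj : j < T) :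
    Indep (MeasurableSpace.comap (fun ω => (N (j + 1) ω : ℤ) - (N j ω : ℤ)) inferInstance)
      (filt μ N j) μ := by
  set f : Fin T → Ω → ℤ := fun l ω => (N ((l : ℕ) + 1) ω : ℤ) - (N l ω : ℤ) with hf
  have h1 := hM.indep.indepFun_finset {⟨j, hj⟩} (univ.filter fun i : Fin T => (i : ℕ) < j)
    (by simp) fun i => hM.measurable_increment i
  have h2 : ∀ i ≤ j, Measurable[MeasurableSpace.comap (fun ω
      (l : (univ.filter fun i : Fin T => (i : ℕ) < j : Finset (Fin T))) => f l ω)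
        MeasurableSpace.pi] fun ω => (N i ω : ℤ) := by
    intro i
    induction i with
    | zero =>
      intro _
      simp only [hM.zero]
      exact measurable_const
    | succ i ih =>
      intro hi
      have h3 : (fun ω => (N (i + 1) ω : ℤ)) =
          fun ω => (N i ω : ℤ) + f ⟨i, by omega⟩ ω := by
        funext ω
        simp [hf]
      rw [h3]
      exact (ih (by omega)).add (measurable_comap_restrict f (by simp; omega))
  have h3 : Indep (MeasurableSpace.comap (fun ω => (N (j + 1) ω : ℤ) - (N j ω : ℤ)) inferInstance)
      (⨆ i ≤ j, MeasurableSpace.comap (N i) ⊤) μ := by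
    refine indep_of_indep_of_le_left (indep_of_indep_of_le_right h1 ?_) ?_
    · refine iSup₂_le fun i hi => ?_
      -- The increments are integers, so `N i` is recovered from its integer cast by `Int.toNat`.
      have h4 : N i = fun ω => ((N i ω : ℤ)).toNat := by
        funext ω
        simp
      rw [← measurable_iff_comap_le, h4]
      exact (measurable_of_countable Int.toNat).comp (h2 i hi)
    · rw [← measurable_iff_comap_le]
      exact measurable_comap_restrict f (Finset.mem_singleton_self (⟨j, hj⟩ : Fin T))
  rw [Indep_iff] at h3 ⊢
  intro s t hs ht
  obtain ⟨⟨t', ht', htt'⟩, -⟩ := measurableSet_filt_iff.1 ht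
  rw [measure_congr htt', ← h3 s t' hs ht']
  exact measure_congr (Filter.EventuallyEq.rfl.inter htt')

lemma integral_sgn_increment {j : ℕ} (hj : j < T) :
    ∫ ω, (-1 : ℝ) ^ ((N (j + 1) ω : ℤ) - (N j ω : ℤ)) ∂μ = Real.exp (-2 * γ j) := by
  rw [← integral_map (φ := fun ω => (N (j + 1) ω : ℤ) - (N j ω : ℤ))
    (f := fun z : ℤ => (-1 : ℝ) ^ z) (hM.measurable_increment j).aemeasurable
    (measurable_of_countable _).aestronglyMeasurable, hM.law j hj,
    integral_map (measurable_of_countable _).aemeasurable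
      (measurable_of_countable _).aestronglyMeasurable, ← integral_neg_one_pow_poisson]
  simp

variable [IsProbabilityMeasure μ]

lemma integrable_sgn (j : ℕ) : Integrable (sgn N j) μ :=
  integrable_of_abs_le (hM.measurable_sgn j).aestronglyMeasurable 1 (abs_sgn_le N j)

/-- The Markov property of the regime, after multiplication by known quantities. -/
lemma condExp_mul_sgn_succ {j : ℕ} (hj : j < T) {B : Ω → ℝ}
    (hB : StronglyMeasurable[filt μ N j] B) {C : ℝ} (hC : ∀ ω, |B ω| ≤ C) :
    μ[fun ω => B ω * sgn N (j + 1) ω | filt μ N j] =ᵐ[μ]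
      fun ω => B ω * (Real.exp (-2 * γ j) * sgn N j ω) := by
  -- `d` is the sign flip over one period: `sgn N (j + 1)` is `sgn N j`, known at time `j`, times
  -- the independent factor `d`.
  set d : Ω → ℝ := fun ω => (-1 : ℝ) ^ ((N (j + 1) ω : ℤ) - (N j ω : ℤ)) with hd
  have h1 : (fun ω => B ω * sgn N (j + 1) ω) = fun ω => (B ω * sgn N j ω) * d ω := by
    funext ω
    rw [mul_assoc]
    congr 1
    simp only [hd, sgn]
    rw [zpow_sub₀ (by norm_num), zpow_natCast, zpow_natCast]
    field_simp
  have hdm : StronglyMeasurable[MeasurableSpace.comap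
      (fun ω => (N (j + 1) ω : ℤ) - (N j ω : ℤ)) inferInstance] d :=
    ((measurable_of_countable fun z : ℤ => (-1 : ℝ) ^ z).comp
      (comap_measurable fun ω => (N (j + 1) ω : ℤ) - (N j ω : ℤ))).stronglyMeasurable
  have hle := (hM.measurable_increment j).comap_le
  have hd1 : ∀ ω, |d ω| ≤ 1 := fun ω => by simp [hd, abs_zpow]
  have hZ : StronglyMeasurable[filt μ N j] fun ω => B ω * sgn N j ω :=
    hB.mul (hM.measurable_sgn_filt le_rfl).stronglyMeasurable
  have hdi : Integrable d μ := integrable_of_abs_le (hdm.mono hle).aestronglyMeasurable 1 hd1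
  rw [h1]
  refine (condExp_mul_of_indep hle ((filt μ N).le j) hZ.aestronglyMeasurable hdm hdi ?_
    (hM.indep_increment hj)).trans (Filter.Eventually.of_forall fun ω => ?_)
  · refine integrable_of_abs_le (C := C) ((hZ.mono ((filt μ N).le j)).mul
      (hdm.mono hle)).aestronglyMeasurable fun ω => ?_
    rw [abs_mul, abs_mul]
    have h2 := abs_nonneg (B ω)
    have h3 := abs_nonneg (sgn N j ω)
    calc |B ω| * |sgn N j ω| * |d ω| ≤ |B ω| * 1 * 1 := by
          gcongr
          · exact abs_sgn_le N j ω
          · exact hd1 ω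
      _ ≤ C := by simpa using hC ω
  · simp only [hd]
    rw [hM.integral_sgn_increment hj]
    ring

lemma condExp_sgn {k ℓ : ℕ} (hkℓ : k ≤ ℓ) (hℓ : ℓ ≤ T) :
    μ[sgn N ℓ | filt μ N k] =ᵐ[μ]
      fun ω => Real.exp (-2 * ∑ i ∈ Ico k ℓ, (γ i : ℝ)) * sgn N k ω := by
  induction ℓ, hkℓ using Nat.le_induction with
  | base =>
    rw [condExp_of_stronglyMeasurable ((filt μ N).le k)
      (hM.measurable_sgn_filt le_rfl).stronglyMeasurable (hM.integrable_sgn k)]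
    simp
  | succ ℓ hkℓ ih =>
    have h1 := hM.condExp_mul_sgn_succ (j := ℓ) (by omega) (B := fun _ => 1)
      stronglyMeasurable_const (C := 1) (by simp)
    simp only [one_mul] at h1
    have h2 : (fun ω => Real.exp (-2 * γ ℓ) * sgn N ℓ ω) = Real.exp (-2 * γ ℓ) • sgn N ℓ := rfl
    rw [h2] at h1
    refine (condExp_condExp_of_le ((filt μ N).mono hkℓ) ((filt μ N).le ℓ)).symm.trans
      ((condExp_congr_ae h1).trans ((condExp_smul _ _ _).trans ?_))
    filter_upwards [ih (by omega)] with ω h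
    rw [Pi.smul_apply, h, Finset.sum_Ico_succ_top hkℓ, smul_eq_mul, mul_add, Real.exp_add]
    ring

lemma condExp_affine {k ℓ : ℕ} (hkℓ : k ≤ ℓ) (hℓ : ℓ ≤ T) (a b : ℝ) :
    μ[fun ω => a + b * sgn N ℓ ω | filt μ N k] =ᵐ[μ]
      fun ω => a + b * (Real.exp (-2 * ∑ i ∈ Ico k ℓ, (γ i : ℝ)) * sgn N k ω) := by
  have h0 : (fun ω => a + b * sgn N ℓ ω) = (fun _ => a) + b • sgn N ℓ := rfl
  have h1 := condExp_add (integrable_const (μ := μ) a) ((hM.integrable_sgn ℓ).smul b) (filt μ N k)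
  have h2 := condExp_smul (μ := μ) b (sgn N ℓ) (filt μ N k)
  rw [h0]
  filter_upwards [h1, h2, hM.condExp_sgn hkℓ hℓ] with ω h1 h2 h3
  rw [h1, Pi.add_apply, h2, Pi.smul_apply, h3, condExp_const ((filt μ N).le k), smul_eq_mul]

/-! #### Prices as functions of the regime -/

lemma binaryPrice_ae {k ℓ : ℕ} (hkℓ : k ≤ ℓ) (hℓ : ℓ ≤ T) :
    binaryPrice μ N k ℓ =ᵐ[μ] fun ω => binaryVal γ k ℓ (regime N k ω) := by
  unfold binaryPrice
  have h : (fun ω => ind (regime N ℓ ω = -1)) = fun ω => 1 / 2 + -1 / 2 * sgn N ℓ ω := by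
    funext ω
    rw [ind_regime_neg]
    ring
  rw [h]
  refine (hM.condExp_affine hkℓ hℓ _ _).trans (Filter.Eventually.of_forall fun ω => ?_)
  simp only [binaryVal_regime]
  ring

lemma binaryPrice0_eq {ℓ : ℕ} (hℓ : ℓ ≤ T) : binaryPrice0 μ N ℓ = binaryVal γ 0 ℓ 1 := by
  have h1 : binaryPrice0 μ N ℓ = ∫ ω, ind (regime N ℓ ω = -1) ∂μ := by
    have hs : MeasurableSet {ω | regime N ℓ ω = -1} :=
      hM.measurable_regime ℓ (measurableSet_singleton _)
    rw [binaryPrice0, ← integral_indicator_one hs]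
    refine integral_congr_ae (Filter.Eventually.of_forall fun ω => ?_)
    by_cases h : regime N ℓ ω = -1
    · simp [h, ind_of_true]
    · simp [h, ind_of_false]
  rw [h1, ← integral_condExp ((filt μ N).le 0)]
  have h2 := hM.binaryPrice_ae (Nat.zero_le ℓ) hℓ
  unfold binaryPrice at h2
  rw [integral_congr_ae h2]
  simp [hM.regime_zero]

lemma hedgePrice_ae (θ : (ℕ → ℕ) → ℕ) {k : ℕ} :
    hedgePrice μ N T θ k =ᵐ[μ] fun ω => ∑ ℓ ∈ Ioc k T,
      (hedgeA μ N θ ℓ * binaryVal γ k ℓ (regime N k ω)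
        - hedgeB μ N θ ℓ * (1 - binaryVal γ k ℓ (regime N k ω))) := by
  set a := hedgeA μ N θ
  set b := hedgeB μ N θ
  unfold hedgePrice
  have h : (fun ω => ∑ ℓ ∈ Ioc k T,
      (a ℓ * ind (regime N ℓ ω = -1) - b ℓ * ind (regime N ℓ ω = 1))) =
      ∑ ℓ ∈ Ioc k T, fun ω => (a ℓ - b ℓ) / 2 + -(a ℓ + b ℓ) / 2 * sgn N ℓ ω := by
    funext ω
    rw [Finset.sum_apply]
    refine Finset.sum_congr rfl fun ℓ _ => ?_
    rw [ind_regime_neg, ind_regime_one]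
    ring
  change μ[fun ω => ∑ ℓ ∈ Ioc k T,
      (a ℓ * ind (regime N ℓ ω = -1) - b ℓ * ind (regime N ℓ ω = 1)) | filt μ N k] =ᵐ[μ] _
  rw [h]
  refine (condExp_finsetSum (fun ℓ _ =>
    (integrable_const _).add ((hM.integrable_sgn ℓ).const_mul _)) _).trans ?_
  refine (eventuallyEq_sum fun ℓ hℓ => hM.condExp_affine (Finset.mem_Ioc.1 hℓ).1.le
    (Finset.mem_Ioc.1 hℓ).2 _ _).trans (Filter.Eventually.of_forall fun ω => ?_)
  rw [Finset.sum_apply]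
  refine Finset.sum_congr rfl fun ℓ _ => ?_
  simp only [binaryVal_regime]
  ring

lemma integrable_apply_regime (f : ℤ → ℝ) (k : ℕ) : Integrable (fun ω => f (regime N k ω)) μ := by
  simp_rw [apply_regime]
  exact (integrable_const _).add ((hM.integrable_sgn k).const_mul _)

end IsMarket

/-! ### Dynamic programming for the fair callable value -/

lemma uProb_nonneg (l : ℕ) : 0 ≤ uProb γ l := by
  unfold uProb
  positivity

lemma vProb_nonneg (l : ℕ) : 0 ≤ vProb γ l := by
  unfold vProb
  have : Real.exp (-2 * γ (l - 1)) ≤ 1 := Real.exp_le_one_iff.2 (by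
    have := (γ (l - 1)).coe_nonneg
    linarith)
  linarith

lemma fairDP_nonneg (T : ℕ) (γ : ℕ → ℝ≥0) (n : ℕ) (s : ℤ) : 0 ≤ fairDP γ T n s := by
  induction n generalizing s with
  | zero => simp [fairDP]
  | succ n ih =>
    unfold fairDP
    split_ifs
    · have h1 := vProb_nonneg (γ := γ) (T - n)
      have h2 := uProb_nonneg (γ := γ) (T - n)
      have := ih 1
      have := ih (-1)
      positivity
    · exact le_max_left _ _

lemma fairVal_neg {k : ℕ} (hk : k < T) : fairVal γ T k (-1) =
    Real.exp (-2 * γ k) + vProb γ (k + 1) * fairVal γ T (k + 1) 1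
      + uProb γ (k + 1) * fairVal γ T (k + 1) (-1) := by
  unfold fairVal
  obtain ⟨n, rfl⟩ : ∃ n, T = k + 1 + n := ⟨T - (k + 1), by omega⟩
  rw [show k + 1 + n - k = n + 1 by omega, show k + 1 + n - (k + 1) = n by omega, fairDP,
    if_pos rfl, show k + 1 + n - (n + 1) = k by omega, show k + 1 + n - n = k + 1 by omega]

lemma fairVal_one {k : ℕ} (hk : k < T) : fairVal γ T k 1 =
    max 0 (-Real.exp (-2 * γ k) + uProb γ (k + 1) * fairVal γ T (k + 1) 1
      + vProb γ (k + 1) * fairVal γ T (k + 1) (-1)) := by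
  unfold fairVal
  obtain ⟨n, rfl⟩ : ∃ n, T = k + 1 + n := ⟨T - (k + 1), by omega⟩
  rw [show k + 1 + n - k = n + 1 by omega, show k + 1 + n - (k + 1) = n by omega, fairDP,
    if_neg (by norm_num), show k + 1 + n - (n + 1) = k by omega,
    show k + 1 + n - n = k + 1 by omega]

lemma fairVal_self (s : ℤ) : fairVal γ T T s = 0 := by simp [fairVal, fairDP]

/-- `essSupFamily` is an arbitrary choice among essential suprema; two of them dominate each other
by minimality. -/
lemma essSupFamily_ae_eq {S : Set (Ω → ℝ)} {Y : Ω → ℝ} (hY : IsEssSup μ S Y) :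
    essSupFamily μ S =ᵐ[μ] Y := by
  have h : ∃ Y, IsEssSup μ S Y := ⟨Y, hY⟩
  have h1 : IsEssSup μ S (essSupFamily μ S) := by
    rw [essSupFamily, dif_pos h]
    exact h.choose_spec
  exact (h1.2.2 Y hY.1 hY.2.1).antisymm (hY.2.2 _ h1.1 h1.2.1)

namespace IsMarket

variable (hM : IsMarket μ T γ N) [IsProbabilityMeasure μ]

include hM

/-- Next flow plus next value is affine in the next sign. In the extreme regime its mean is exactly
the recursion, where no maximum is needed because all terms are nonnegative. In the normal regime it
is the continuation value, to which the recursion still applies `max 0`. -/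
lemma condExp_fair_step {j : ℕ} (hj : j < T) :
    μ[(fun ω => ind (regime N (j + 1) ω = -1) - ind (regime N (j + 1) ω = 1))
      + (fun ω => fairVal γ T (j + 1) (regime N (j + 1) ω)) | filt μ N j] =ᵐ[μ]
      fun ω => if regime N j ω = -1 then fairVal γ T j (-1) else
        -Real.exp (-2 * γ j) + uProb γ (j + 1) * fairVal γ T (j + 1) 1
          + vProb γ (j + 1) * fairVal γ T (j + 1) (-1) := by
  set D := fairVal γ T (j + 1) with hD
  have h : (fun ω => ind (regime N (j + 1) ω = -1) - ind (regime N (j + 1) ω = 1))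
      + (fun ω => D (regime N (j + 1) ω)) =
      fun ω => (D 1 + D (-1)) / 2 + ((D 1 - D (-1)) / 2 - 1) * sgn N (j + 1) ω := by
    funext ω
    simp only [Pi.add_apply]
    rw [ind_regime_neg, ind_regime_one, apply_regime N D]
    ring
  rw [h]
  refine (hM.condExp_affine (Nat.le_succ j) hj _ _).trans (Filter.Eventually.of_forall fun ω => ?_)
  simp only [Nat.Ico_succ_singleton, Finset.sum_singleton]
  rw [sgn_eq_cast, fairVal_neg hj, ← hD]
  unfold uProb vProb
  rw [Nat.add_sub_cancel]
  rcases regime_eq_or N j ω with h | h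
  · rw [h, if_neg (by norm_num)]
    push_cast
    ring
  · rw [h, if_pos rfl]
    push_cast
    ring

/-- The supersolution property makes the explicit value an upper bound of the family. It is the
least one because some rule attains it, so it lies below any other bound. -/
theorem isEssSup_fairVal {k : ℕ} (hk : k ≤ T) :
    IsEssSup μ {Y | ∃ τ, IsRule μ N T k τ ∧
      Y = μ[fun ω => ∑ ℓ ∈ Ioc k T,
        (ind (regime N ℓ ω = -1) - ind (regime N ℓ ω = 1)) * ind (ℓ ≤ τ ω) | filt μ N k]}
      (fun ω => fairVal γ T k (regime N k ω)) := by
  set c : ℕ → Ω → ℝ := fun ℓ ω => ind (regime N ℓ ω = -1) - ind (regime N ℓ ω = 1) with hc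
  set V : ℕ → Ω → ℝ := fun ℓ ω => fairVal γ T ℓ (regime N ℓ ω) with hV
  have hci : ∀ j, Integrable (c j) μ := fun j =>
    hM.integrable_apply_regime (fun s => ind (s = -1) - ind (s = 1)) j
  have hVi : ∀ j, k ≤ j → j ≤ T → Integrable (V j) μ := fun j _ _ =>
    hM.integrable_apply_regime (fairVal γ T j) j
  have hVm : ∀ j, k ≤ j → j ≤ T → StronglyMeasurable[filt μ N j] (V j) := fun j _ _ =>
    hM.stronglyMeasurable_apply_regime (fairVal γ T j) j
  refine ⟨(hVi k le_rfl hk).aemeasurable, ?_, ?_⟩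
  · rintro X ⟨τ, ⟨hτ, hτk⟩, rfl⟩
    refine condExp_stoppedSum_le hk hci hVi hVm (fun j _ _ ω => fairDP_nonneg _ _ _ _)
      (fun j _ hj => ?_) hτ hτk
    filter_upwards [hM.condExp_fair_step hj] with ω h
    rw [h]
    simp only [hV]
    rcases regime_eq_or N j ω with h | h
    · rw [h, if_neg (by norm_num), fairVal_one hj]
      exact le_max_right _ _
    · rw [h, if_pos rfl]
  · intro Z _ hZ
    obtain ⟨τ, hτ, hτk, h⟩ := exists_condExp_stoppedSum_eq hk hci hVi hVm
      (fun ω => fairVal_self _) (fun j _ hj => by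
        filter_upwards [hM.condExp_fair_step hj] with ω h
        intro hne
        rw [h]
        simp only [hV] at hne ⊢
        rcases regime_eq_or N j ω with h | h
        · rw [h, fairVal_one hj] at hne ⊢
          rw [if_neg (by norm_num)]
          exact ((max_choice _ _).resolve_left hne).symm
        · rw [h, if_pos rfl])
    exact h.symm.le.trans (hZ _ ⟨τ, ⟨hτ, hτk⟩, rfl⟩)

theorem fairValue_ae {k : ℕ} (hk : k ≤ T) :
    fairValue μ N T k =ᵐ[μ] fun ω => fairVal γ T k (regime N k ω) :=
  essSupFamily_ae_eq (hM.isEssSup_fairVal hk)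

end IsMarket

/-! ### Calibration of the trader's model to the binary prices -/

lemma cumIntensity_binaryVal (γ : ℕ → ℝ≥0) (k ℓ : ℕ) :
    cumIntensity (fun ℓ => binaryVal γ k ℓ 1) k ℓ =
      -Real.log ((1 + Real.exp (-2 * ∑ i ∈ Ico k ℓ, (γ i : ℝ))) / 2) := by
  unfold cumIntensity binaryVal
  simp only [if_true]
  split_ifs with h
  -- For `ℓ ≤ k` the sum is empty and the logarithm is that of `1`, in agreement with the default
  -- value `0`.
  · simp [Finset.Ico_eq_empty_of_le h]
  · congr 2
    ring

/-- The implied survival curve `(1 + exp (-2 Γ)) / 2` decreases with maturity. Nonnegativity matters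
because `traderLaw` truncates intensities by `Real.toNNReal`. -/
lemma calibRate_binaryVal_nonneg (γ : ℕ → ℝ≥0) (k l : ℕ) :
    0 ≤ calibRate (fun ℓ => binaryVal γ k ℓ 1) k l := by
  unfold calibRate
  rw [cumIntensity_binaryVal, cumIntensity_binaryVal, sub_nonneg, neg_le_neg_iff]
  refine Real.log_le_log (by positivity) ?_
  have h : ∑ i ∈ Ico k l, (γ i : ℝ) ≤ ∑ i ∈ Ico k (l + 1), (γ i : ℝ) :=
    Finset.sum_le_sum_of_subset_of_nonneg (Finset.Ico_subset_Ico_right (Nat.le_succ l))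
      fun i _ _ => (γ i).coe_nonneg
  gcongr (1 + Real.exp ?_) / 2
  linarith

lemma calibRate_congr {p p' : ℕ → ℝ} {k : ℕ} (h : ∀ ℓ, k ≤ ℓ → ℓ ≤ T → p ℓ = p' ℓ) {l : ℕ}
    (hkl : k ≤ l) (hl : l < T) : calibRate p k l = calibRate p' k l := by
  unfold calibRate cumIntensity
  rw [h l hkl hl.le, h (l + 1) (by omega) hl]

/-- Calibration to the market prices in the normal regime. -/
lemma traderValue_eq_traderVal {p : ℕ → ℝ} {k : ℕ} (hk : k ≤ T)
    (h : ∀ ℓ, k ≤ ℓ → ℓ ≤ T → p ℓ = binaryVal γ k ℓ 1) :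
    traderValue p k T 1 = traderVal γ T k k 1 := by
  have h1 : ∀ l, k ≤ l → l < T → calibRate p k l = calibRate (fun ℓ => binaryVal γ k ℓ 1) k l :=
    fun l h1 h2 => calibRate_congr h h1 h2
  rw [traderValue_eq hk fun l h2 h3 => (h1 l h2 h3).symm ▸ calibRate_binaryVal_nonneg γ k l]
  exact traderDP_congr (Nat.sub_le _ _) fun l h2 h3 => h1 l (by omega) h3

namespace IsMarket

variable (hM : IsMarket μ T γ N) [IsProbabilityMeasure μ]

include hM

theorem traderPrice_ae {k : ℕ} (hk : k ≤ T) :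
    ∀ᵐ ω ∂μ, regime N k ω = 1 → traderPrice μ N T k ω = traderVal γ T k k 1 := by
  have h := (Filter.eventually_all_finset (l := ae μ) (Icc k T)).2 fun ℓ hℓ =>
    hM.binaryPrice_ae (Finset.mem_Icc.1 hℓ).1 (Finset.mem_Icc.1 hℓ).2
  filter_upwards [h] with ω hω h1
  rw [traderPrice, h1]
  refine traderValue_eq_traderVal hk fun ℓ h2 h3 => ?_
  rw [hω ℓ (Finset.mem_Icc.2 ⟨h2, h3⟩), h1]

/-- The static hedge of the bad trader costs the trader's price of the asset. -/
theorem traderVal_zero_eq_hedge {θ : (ℕ → ℕ) → ℕ}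
    (hθ : IsOptimalTraderRule (binaryPrice0 μ N) 0 T 1 θ) :
    traderVal γ T 0 0 1 = ∑ ℓ ∈ Ioc 0 T, (hedgeA μ N θ ℓ * binaryVal γ 0 ℓ 1
      - hedgeB μ N θ ℓ * (1 - binaryVal γ 0 ℓ 1)) := by
  set p := binaryPrice0 μ N with hp
  have hpv : ∀ ℓ, 0 ≤ ℓ → ℓ ≤ T → p ℓ = binaryVal γ 0 ℓ 1 := fun ℓ _ h => hM.binaryPrice0_eq h
  set ν := calibRate p 0 with hν
  have hν0 : ∀ l < T, 0 ≤ ν l := fun l hl => by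
    rw [hν, calibRate_congr hpv (Nat.zero_le l) hl]
    exact calibRate_binaryVal_nonneg γ 0 l
  have hθm := measurable_of_isTraderRule hθ.1
  have hi : ∀ (f : (ℕ → ℕ) → ℝ) (ℓ : ℕ), Integrable f (traderLaw ν) →
      Integrable (fun x => f x * ind (ℓ ≤ θ x)) (traderLaw ν) := fun f ℓ hf => by
    simp_rw [mul_comm (f _)]
    exact integrable_ind_mul le_rfl
      (measurable_ind (hθm measurableSet_Ici)).aestronglyMeasurable hf
  have hi1 : ∀ ℓ, Integrable (fun x => ind (traderRegime 0 1 ℓ x = -1)) (traderLaw ν) := fun ℓ => by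
    simp_rw [ind_traderRegime_neg]
    exact (integrable_const _).sub (integrable_survival 0 ℓ)
  have hi2 : ∀ ℓ, Integrable (fun x => ind (traderRegime 0 1 ℓ x = 1)) (traderLaw ν) := fun ℓ => by
    simp_rw [ind_traderRegime_one]
    exact integrable_survival 0 ℓ
  rw [← traderValue_eq_traderVal (Nat.zero_le T) hpv, ← traderReward_of_isOptimal hθ, traderReward]
  simp_rw [sub_mul]
  have hi3 : ∀ ℓ, Integrable (fun x => ind (traderRegime 0 1 ℓ x = -1) * ind (ℓ ≤ θ x) -
      ind (traderRegime 0 1 ℓ x = 1) * ind (ℓ ≤ θ x)) (traderLaw ν) := fun ℓ =>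
    (hi _ ℓ (hi1 ℓ)).sub (hi _ ℓ (hi2 ℓ))
  rw [integral_finsetSum _ fun ℓ _ => hi3 ℓ]
  refine Finset.sum_congr rfl fun ℓ hℓ => ?_
  have hℓT := (Finset.mem_Ioc.1 hℓ).2
  -- The price `p ℓ` is below `1 / 2`, so the denominator of `b_0` never vanishes.
  have h2 : (1 : ℝ) - p ℓ ≠ 0 := by
    rw [hpv ℓ (Nat.zero_le _) hℓT]
    unfold binaryVal
    rw [if_pos rfl]
    have := Real.exp_pos (-2 * ∑ j ∈ Ico 0 ℓ, (γ j : ℝ))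
    intro h
    linarith
  have h1 : ∫ x, ind (traderRegime 0 1 ℓ x = -1) ∂(traderLaw ν) = p ℓ := by
    simp_rw [ind_traderRegime_neg]
    rw [integral_sub (integrable_const _) (integrable_survival 0 ℓ),
      integral_survival (Nat.zero_le ℓ) fun j _ hj => hν0 j (by omega)]
    -- The calibrated intensities telescope, so the model reprices the binary option.
    have h3 : ∑ j ∈ Ico 0 ℓ, ν j = cumIntensity p 0 ℓ := by
      rw [← Finset.range_eq_Ico]
      simp only [hν, calibRate]
      rw [Finset.sum_range_sub]
      simp [cumIntensity]
    have h4 : ℓ ≠ 0 := by have := (Finset.mem_Ioc.1 hℓ).1; omega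
    have h5 : 0 < 1 - p ℓ := by
      rw [hpv ℓ (Nat.zero_le _) hℓT]
      unfold binaryVal
      rw [if_pos rfl]
      have := Real.exp_pos (-2 * ∑ j ∈ Ico 0 ℓ, (γ j : ℝ))
      linarith
    rw [h3, cumIntensity, if_neg (by omega), neg_neg, Real.exp_log h5]
    simp
  rw [integral_sub (hi _ ℓ (hi1 ℓ)) (hi _ ℓ (hi2 ℓ)), ← hpv ℓ (Nat.zero_le _) hℓT]
  unfold hedgeA hedgeB
  rw [← hp, ← hν, div_mul_cancel₀ _ h2]
  congr 1
  -- If `p ℓ = 0`, division by zero gives `a_0 = 0`. This is harmless: the numerator is nonnegative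
  -- and at most `p ℓ`, hence zero as well.
  by_cases h0 : p ℓ = 0
  · rw [h0, mul_zero]
    refine le_antisymm ?_ (integral_nonneg fun x => mul_nonneg (ind_nonneg _) (ind_nonneg _))
    rw [← h0, ← h1]
    refine integral_mono (hi _ ℓ (hi1 ℓ)) (hi1 ℓ) fun x => ?_
    exact mul_le_of_le_one_right (ind_nonneg _) (ind_le_one _)
  · rw [div_mul_cancel₀ _ h0]

end IsMarket

end Market

/-! ### The first time in the extreme regime -/

/-- The first time in the extreme regime, `T + 1` if there is none up to `T`. -/
noncomputable def firstTime {Ω : Type*} (N : ℕ → Ω → ℕ) (T : ℕ) (ω : Ω) : ℕ :=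
  sInf {l | l = T + 1 ∨ regime N l ω = -1}

section FirstTime

variable {Ω : Type*} {N : ℕ → Ω → ℕ} {T : ℕ} {ω : Ω}

lemma firstTime_mem : firstTime N T ω = T + 1 ∨ regime N (firstTime N T ω) ω = -1 :=
  Nat.sInf_mem (s := {l | l = T + 1 ∨ regime N l ω = -1}) ⟨T + 1, Or.inl rfl⟩

lemma firstTime_le : firstTime N T ω ≤ T + 1 := Nat.sInf_le (Or.inl rfl)

lemma regime_of_lt_firstTime {j : ℕ} (h : j < firstTime N T ω) : regime N j ω = 1 :=
  (regime_eq_or N j ω).resolve_right fun h' => Nat.notMem_of_lt_sInf h (Or.inr h')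

lemma regime_firstTime (h : firstTime N T ω ≤ T) : regime N (firstTime N T ω) ω = -1 :=
  firstTime_mem.resolve_left (by omega)

lemma lt_firstTime_iff {j : ℕ} (hj : j ≤ T) :
    j < firstTime N T ω ↔ ∀ i ≤ j, regime N i ω = 1 := by
  refine ⟨fun h i hi => regime_of_lt_firstTime (hi.trans_lt h), fun h => ?_⟩
  by_contra hlt
  rw [not_lt] at hlt
  have h1 := h _ hlt
  rw [regime_firstTime (hlt.trans hj)] at h1
  norm_num at h1

lemma firstTime_pos (h0 : regime N 0 ω = 1) : 1 ≤ firstTime N T ω :=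
  (lt_firstTime_iff (Nat.zero_le T)).2 fun i hi => by rwa [Nat.le_zero.1 hi]

lemma mem_firstEvent_iff {l : ℕ} (hl : l ≤ T + 1) :
    ω ∈ firstEvent N T l ↔ firstTime N T ω = l := by
  constructor
  · rintro ⟨h1, h2⟩
    refine le_antisymm (Nat.sInf_le ?_) ?_
    · rcases Nat.lt_or_ge T l with h | h
      · exact Or.inl (by omega)
      · exact Or.inr (h2 h)
    · by_contra hlt
      rw [not_le] at hlt
      have := h1 _ hlt
      rw [regime_firstTime (by omega)] at this
      norm_num at this
  · rintro rfl
    exact ⟨fun j hj => regime_of_lt_firstTime hj, regime_firstTime⟩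

/-- The bound on `j` is essential: after the first extreme date the regime may return to `1`. It
will be met because the exit precedes the switch. -/
lemma regime_eq_regimeVal {j : ℕ} (h : j ≤ min (firstTime N T ω) T) :
    regime N j ω = regimeVal (firstTime N T ω) j := by
  rw [le_min_iff] at h
  unfold regimeVal
  split_ifs with h1
  · rw [h1]
    exact regime_firstTime (h1 ▸ h.2)
  · exact regime_of_lt_firstTime (lt_of_le_of_ne h.1 h1)

lemma switchTime_eq : switchTime N T ω = switchVal T (firstTime N T ω) := by
  unfold switchVal
  refine le_antisymm (Nat.sInf_le ?_) ?_
  · rcases Nat.lt_or_ge T (firstTime N T ω) with h | h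
    · exact Or.inl (min_eq_right h.le)
    · right
      rw [min_eq_left h]
      exact regime_firstTime h
  · have hmem : switchTime N T ω = T ∨ regime N (switchTime N T ω) ω = -1 :=
      Nat.sInf_mem (s := {k | k = T ∨ regime N k ω = -1}) ⟨T, Or.inl rfl⟩
    rcases hmem with h | h
    · rw [h]
      exact min_le_right _ _
    · exact (min_le_left _ _).trans (Nat.sInf_le (Or.inr h))

end FirstTime

/-! ### Explicit conditional probabilities -/

section CondProb

variable {γ : ℕ → ℝ≥0} {T : ℕ}

lemma condProbVal_of_le {k m l : ℕ} (hk : k ≤ T) (hm : m ≤ T + 1) (hl : l ≤ k) :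
    condProbVal γ T k m l = ind (l = m) := by
  unfold condProbVal
  rw [ind_of_false (not_lt.2 hl)]
  split_ifs with h
  · by_cases h1 : l = m
    · rw [ind_of_true (h1 ▸ hl)]
      ring
    · rw [ind_of_false h1]
      ring
  · rw [ind_of_false (by omega : ¬ l = m), zero_mul]

/-- At maturity everything is known, including the scenario `T + 1` without any extreme date, which
`condProbVal_of_le` does not reach. -/
lemma condProbVal_self {m l : ℕ} (hm : m ≤ T + 1) (hl : l ≤ T + 1) :
    condProbVal γ T T m l = ind (l = m) := by
  rcases Nat.lt_or_ge T l with h | h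
  · unfold condProbVal
    split_ifs with h1
    · rw [ind_of_false (by omega : ¬ l = m), ind_of_false (not_lt.2 h1)]
      ring
    · rw [ind_of_true h, ind_of_true (by omega : l = m)]
      simp
  · exact condProbVal_of_le le_rfl hm h

/-- Scenarios that are still in the normal regime at time `k` cannot be told apart then. The
scenario `T + 1` represents them all. -/
lemma condProbVal_of_lt {k m l : ℕ} (hk : k ≤ T) (hl : k < l) :
    condProbVal γ T k m l = condProbVal γ T k m (T + 1) := by
  have h : ind (m ≤ k) * ind (l = m) = 0 := by
    by_cases h1 : m ≤ k
    · rw [ind_of_false (by omega : ¬ l = m), mul_zero]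
    · rw [ind_of_false h1, zero_mul]
  have h' : ind (m ≤ k) * ind (T + 1 = m) = 0 := by
    by_cases h1 : m ≤ k
    · rw [ind_of_false (by omega : ¬ T + 1 = m), mul_zero]
    · rw [ind_of_false h1, zero_mul]
  unfold condProbVal
  rw [h, h', ind_of_true hl, ind_of_true (Nat.lt_succ_of_le hk)]

lemma condProbVal_of_le_of_lt {k m l : ℕ} (hk : k ≤ T) (hl : k < l) (hm : m ≤ k) :
    condProbVal γ T k m l = 0 := by
  unfold condProbVal
  rw [if_pos (hm.trans hk), ind_of_false (by omega : ¬ l = m), ind_of_false (not_lt.2 hm)]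
  ring

/-- One step of the chain from the normal regime: it turns extreme at `k + 1` with weight `v`, or
survives with weight `u` and starts afresh from `k + 1`. -/
lemma condProbVal_step {k m : ℕ} (hk : k < T) (hm : m ≤ T + 1) :
    condProbVal γ T k m (T + 1) = vProb γ (k + 1) * ind (k + 1 = m)
      + uProb γ (k + 1) * condProbVal γ T (k + 1) m (T + 1) := by
  rcases Nat.lt_trichotomy m (k + 1) with h | h | h
  · rw [condProbVal_of_le_of_lt hk.le (by omega) (by omega),
      condProbVal_of_le_of_lt hk (by omega) (by omega), ind_of_false (by omega)]
    ring
  · subst h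
    rw [condProbVal_of_le_of_lt (k := k + 1) hk (by omega) le_rfl, ind_of_true rfl]
    unfold condProbVal
    have h2 : Ioo k (k + 1) = ∅ := Finset.eq_empty_of_forall_notMem fun i hi => by
      rw [Finset.mem_Ioo] at hi
      omega
    rw [if_pos (by omega : k + 1 ≤ T), ind_of_false (by omega : ¬ k + 1 ≤ k),
      ind_of_true (Nat.lt_succ_self k), ind_of_true (by omega : k < T + 1), h2]
    simp
  · rw [ind_of_false (by omega)]
    unfold condProbVal
    split_ifs with h1
    · rw [ind_of_false (by omega : ¬ m ≤ k), ind_of_false (by omega : ¬ m ≤ k + 1),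
        ind_of_true (by omega : k < m), ind_of_true h, ind_of_true (by omega : k < T + 1),
        ind_of_true (by omega : k + 1 < T + 1)]
      have h2 : Ioo k m = insert (k + 1) (Ioo (k + 1) m) := by
        ext i
        simp only [Finset.mem_insert, Finset.mem_Ioo]
        omega
      rw [h2, Finset.prod_insert (by simp)]
      ring
    · rw [ind_of_true (by omega : k < T + 1), ind_of_true (by omega : k + 1 < T + 1)]
      have h2 : Ioc k T = insert (k + 1) (Ioc (k + 1) T) := by
        ext i
        simp only [Finset.mem_insert, Finset.mem_Ioc]
        omega
      rw [h2, Finset.prod_insert (by simp)]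
      ring

/-- The explicit conditional expectation given `𝔉_k`, on `Ω_l`, of a function `ξ` of the first
time in the extreme regime. -/
noncomputable def condVal (γ : ℕ → ℝ≥0) (T k : ℕ) (ξ : ℕ → ℝ) (l : ℕ) : ℝ :=
  ∑ m ∈ Icc 1 (T + 1), ξ m * condProbVal γ T k m l

lemma sum_mul_ind_eq {s : Finset ℕ} (ξ : ℕ → ℝ) {l : ℕ} (hl : l ∈ s) :
    ∑ m ∈ s, ξ m * ind (l = m) = ξ l := by
  rw [Finset.sum_eq_single l]
  · simp [ind_of_true]
  · intro m _ hm
    rw [ind_of_false (Ne.symm hm), mul_zero]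
  · exact fun h => absurd hl h

lemma condVal_of_le {k l : ℕ} (ξ : ℕ → ℝ) (hk : k ≤ T) (h1 : 1 ≤ l) (hl : l ≤ k) :
    condVal γ T k ξ l = ξ l := by
  rw [← sum_mul_ind_eq (s := Icc 1 (T + 1)) ξ (Finset.mem_Icc.2 ⟨h1, by omega⟩)]
  exact Finset.sum_congr rfl fun m hm => by
    rw [condProbVal_of_le hk (Finset.mem_Icc.1 hm).2 hl]

lemma condVal_self {l : ℕ} (ξ : ℕ → ℝ) (h1 : 1 ≤ l) (hl : l ≤ T + 1) :
    condVal γ T T ξ l = ξ l := by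
  rw [← sum_mul_ind_eq (s := Icc 1 (T + 1)) ξ (Finset.mem_Icc.2 ⟨h1, hl⟩)]
  exact Finset.sum_congr rfl fun m hm => by
    rw [condProbVal_self (Finset.mem_Icc.1 hm).2 hl]

lemma condVal_of_lt {k l : ℕ} (ξ : ℕ → ℝ) (hk : k ≤ T) (hl : k < l) :
    condVal γ T k ξ l = condVal γ T k ξ (T + 1) :=
  Finset.sum_congr rfl fun m _ => by rw [condProbVal_of_lt hk hl]

lemma condVal_step {k : ℕ} (ξ : ℕ → ℝ) (hk : k < T) :
    condVal γ T k ξ (T + 1) =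
      vProb γ (k + 1) * ξ (k + 1) + uProb γ (k + 1) * condVal γ T (k + 1) ξ (T + 1) := by
  have h := sum_mul_ind_eq (s := Icc 1 (T + 1)) ξ (l := k + 1)
    (Finset.mem_Icc.2 ⟨by omega, by omega⟩)
  rw [← h]
  unfold condVal
  rw [Finset.mul_sum, Finset.mul_sum, ← Finset.sum_add_distrib]
  refine Finset.sum_congr rfl fun m hm => ?_
  rw [condProbVal_step hk (Finset.mem_Icc.1 hm).2]
  ring

lemma condVal_add (k : ℕ) (ξ η : ℕ → ℝ) (l : ℕ) :
    condVal γ T k (fun m => ξ m + η m) l = condVal γ T k ξ l + condVal γ T k η l := by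
  unfold condVal
  rw [← Finset.sum_add_distrib]
  exact Finset.sum_congr rfl fun m _ => by ring

end CondProb

/-! ### Conditional expectations of functions of the first time -/

section Market

variable {Ω : Type*} {mΩ : MeasurableSpace Ω} {μ : Measure Ω} {T : ℕ} {γ : ℕ → ℝ≥0}
  {N : ℕ → Ω → ℕ}

namespace IsMarket

variable (hM : IsMarket μ T γ N)

include hM

/-- Truncation at `k + 1` keeps precisely what is known at time `k`: whether the extreme regime has
occurred by then, and when. -/
lemma measurable_min_firstTime {k : ℕ} (hk : k ≤ T) :
    Measurable[filt μ N k] fun ω => min (firstTime N T ω) (k + 1) := by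
  refine measurable_of_Ioi fun n => ?_
  rcases Nat.lt_or_ge k n with hn | hn
  · convert MeasurableSet.empty
    ext ω
    simp
    omega
  · have h : (fun ω => min (firstTime N T ω) (k + 1)) ⁻¹' Set.Ioi n =
        ⋂ i ∈ range (n + 1), {ω | regime N i ω = 1} := by
      ext ω
      simp only [Set.mem_preimage, Set.mem_Ioi, lt_min_iff, Set.mem_iInter, Finset.mem_range,
        Nat.lt_succ_iff, lt_firstTime_iff (hn.trans hk)]
      exact ⟨fun h => h.1, fun h => ⟨h, hn⟩⟩
    rw [h]
    refine Finset.measurableSet_biInter _ fun i hi => ?_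
    rw [Finset.mem_range] at hi
    exact hM.measurable_regime_filt (by omega) (measurableSet_singleton (1 : ℤ))

/-- Functions of the first time that are constant after `k` are known at time `k`. -/
lemma stronglyMeasurable_firstTime {k : ℕ} (hk : k ≤ T) {f : ℕ → ℝ}
    (hf : ∀ l, k < l → l ≤ T + 1 → f l = f (k + 1)) :
    StronglyMeasurable[filt μ N k] fun ω => f (firstTime N T ω) := by
  have h : (fun ω => f (firstTime N T ω)) = f ∘ fun ω => min (firstTime N T ω) (k + 1) := by
    funext ω
    rw [Function.comp_apply]
    rcases Nat.lt_or_ge k (firstTime N T ω) with h | h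
    · rw [min_eq_right h, hf _ h firstTime_le]
    · rw [min_eq_left (by omega)]
  rw [h]
  exact ((measurable_of_countable f).comp (hM.measurable_min_firstTime hk)).stronglyMeasurable

lemma measurable_firstTime : Measurable (firstTime N T) := by
  have h : firstTime N T = fun ω => min (firstTime N T ω) (T + 1) := by
    funext ω
    rw [min_eq_left firstTime_le]
  rw [h]
  exact (hM.measurable_min_firstTime le_rfl).mono ((filt μ N).le T) le_rfl

variable [IsProbabilityMeasure μ]

lemma integrable_firstTime (f : ℕ → ℝ) : Integrable (fun ω => f (firstTime N T ω)) μ := by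
  refine integrable_of_abs_le (C := ∑ l ∈ range (T + 2), |f l|)
    ((measurable_of_countable f).comp hM.measurable_firstTime).aestronglyMeasurable fun ω => ?_
  exact Finset.single_le_sum (f := fun l => |f l|) (fun l _ => abs_nonneg _)
    (Finset.mem_range.2 (Nat.lt_succ_of_le firstTime_le))

lemma condExp_firstTime_of_const {k : ℕ} (hk : k ≤ T) {f : ℕ → ℝ}
    (hf : ∀ l, k < l → l ≤ T + 1 → f l = f (k + 1)) :
    μ[fun ω => f (firstTime N T ω) | filt μ N k] = fun ω => f (firstTime N T ω) :=
  condExp_of_stronglyMeasurable ((filt μ N).le k) (hM.stronglyMeasurable_firstTime hk hf)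
    (hM.integrable_firstTime f)

/-- If the first time is at most `k`, the value is already known. Otherwise it takes two values
according to the regime at `k + 1`, so it is affine in `sgn N (k + 1)` and the Markov property
applies. The outcome matches `condVal_step`. -/
lemma condExp_condVal_succ {k : ℕ} (hk : k < T) (ξ : ℕ → ℝ) :
    μ[fun ω => condVal γ T (k + 1) ξ (firstTime N T ω) | filt μ N k] =ᵐ[μ]
      fun ω => condVal γ T k ξ (firstTime N T ω) := by
  set w := condVal γ T (k + 1) ξ (T + 1) with hw
  -- `A + B * s` interpolates between `ξ (k + 1)` at `s = -1` and `w` at `s = 1`; both coefficients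
  -- are constant beyond `k`, hence known at time `k`.
  set A : ℕ → ℝ := fun l => if l ≤ k then ξ l else (ξ (k + 1) + w) / 2 with hA
  set B : ℕ → ℝ := fun l => if l ≤ k then 0 else (w - ξ (k + 1)) / 2 with hB
  have hAm : ∀ l, k < l → l ≤ T + 1 → A l = A (k + 1) := fun l h _ => by
    simp only [hA]
    rw [if_neg (by omega), if_neg (by omega)]
  have hBm : ∀ l, k < l → l ≤ T + 1 → B l = B (k + 1) := fun l h _ => by
    simp only [hB]
    rw [if_neg (by omega), if_neg (by omega)]
  have h1 : (fun ω => condVal γ T (k + 1) ξ (firstTime N T ω)) =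
      (fun ω => A (firstTime N T ω)) + fun ω => B (firstTime N T ω) * sgn N (k + 1) ω := by
    funext ω
    simp only [Pi.add_apply, hA, hB]
    have hpos : 1 ≤ firstTime N T ω := firstTime_pos (hM.regime_zero ω)
    rcases Nat.lt_trichotomy (firstTime N T ω) (k + 1) with h | h | h
    · rw [if_pos (by omega), if_pos (by omega), condVal_of_le ξ hk hpos (by omega)]
      ring
    · have h2 : regime N (k + 1) ω = -1 := by
        rw [← h]
        exact regime_firstTime (by omega)
      rw [if_neg (by omega), if_neg (by omega), condVal_of_le ξ hk hpos (by omega), sgn_eq_cast,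
        h2, h]
      push_cast
      ring
    · have h2 : regime N (k + 1) ω = 1 := regime_of_lt_firstTime h
      rw [if_neg (by omega), if_neg (by omega), condVal_of_lt ξ hk h, sgn_eq_cast, h2, ← hw]
      push_cast
      ring
  have hBb : ∀ ω, |B (firstTime N T ω)| ≤ |(w - ξ (k + 1)) / 2| := fun ω => by
    simp only [hB]
    split_ifs
    · simp
    · exact le_rfl
  have hBs := hM.stronglyMeasurable_firstTime hk.le hBm
  have hi : Integrable (fun ω => B (firstTime N T ω) * sgn N (k + 1) ω) μ := by
    refine (hM.integrable_sgn (k + 1)).bdd_mul (c := |(w - ξ (k + 1)) / 2|)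
      (hBs.mono ((filt μ N).le k)).aestronglyMeasurable
      (Filter.Eventually.of_forall fun ω => ?_)
    rw [Real.norm_eq_abs]
    exact hBb ω
  rw [h1]
  have h2 := condExp_add (hM.integrable_firstTime A) hi (filt μ N k)
  rw [hM.condExp_firstTime_of_const hk.le hAm] at h2
  filter_upwards [h2, hM.condExp_mul_sgn_succ hk hBs hBb] with ω h2 h3
  rw [h2, Pi.add_apply, h3]
  have hpos : 1 ≤ firstTime N T ω := firstTime_pos (hM.regime_zero ω)
  simp only [hA, hB]
  rcases Nat.lt_or_ge k (firstTime N T ω) with h | h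
  · rw [if_neg (by omega), if_neg (by omega), condVal_of_lt ξ hk.le h, condVal_step ξ hk, ← hw,
      sgn_eq_cast, regime_of_lt_firstTime h]
    unfold uProb vProb
    rw [Nat.add_sub_cancel]
    push_cast
    ring
  · rw [if_pos h, if_pos h, condVal_of_le ξ hk.le hpos h]
    ring

/-- Backward induction from maturity, by the tower property and `IsMarket.condExp_condVal_succ`. -/
theorem condExp_firstTime {k : ℕ} (hk : k ≤ T) (ξ : ℕ → ℝ) :
    μ[fun ω => ξ (firstTime N T ω) | filt μ N k] =ᵐ[μ]
      fun ω => condVal γ T k ξ (firstTime N T ω) := by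
  induction hk using Nat.decreasingInduction with
  | self =>
    rw [hM.condExp_firstTime_of_const le_rfl fun l h1 h2 => by rw [show l = T + 1 by omega]]
    exact Filter.Eventually.of_forall fun ω =>
      (condVal_self ξ (firstTime_pos (hM.regime_zero ω)) firstTime_le).symm
  | of_succ k hk ih =>
    exact (condExp_condExp_of_le ((filt μ N).mono (Nat.le_succ k)) ((filt μ N).le _)).symm.trans
      ((condExp_congr_ae ih).trans (hM.condExp_condVal_succ hk ξ))

end IsMarket

end Market

/-! ### The explicit exit time -/

section Exit

variable {γ : ℕ → ℝ≥0} {T : ℕ}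

lemma lt_exitVal_iff {l j : ℕ} : j < exitVal γ T l ↔
    j < switchVal T l ∧ ∀ i ≤ j, traderVal γ T i i 1 ≠ 0 := by
  have hle : exitVal γ T l ≤ switchVal T l := Nat.sInf_le (Or.inl rfl)
  constructor
  · intro h
    refine ⟨h.trans_le hle, fun i hi h0 => ?_⟩
    exact Nat.notMem_of_lt_sInf (hi.trans_lt h) (Or.inr ⟨by omega, h0⟩)
  · rintro ⟨h1, h2⟩
    by_contra hlt
    rw [not_lt] at hlt
    have hmem : exitVal γ T l = switchVal T l ∨
        (exitVal γ T l < switchVal T l ∧ traderVal γ T (exitVal γ T l) (exitVal γ T l) 1 = 0) :=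
      Nat.sInf_mem (s := {k | k = switchVal T l ∨
        (k < switchVal T l ∧ traderVal γ T k k 1 = 0)}) ⟨_, Or.inl rfl⟩
    rcases hmem with h | ⟨-, h⟩
    · omega
    · exact h2 _ hlt h

lemma exitVal_le_switchVal (l : ℕ) : exitVal γ T l ≤ switchVal T l := Nat.sInf_le (Or.inl rfl)

lemma exitVal_le (l : ℕ) : exitVal γ T l ≤ T := (exitVal_le_switchVal l).trans (min_le_right _ _)

/-- Whether the exit is later than `k` depends on the scenario only through its normal regime up to
`k`. All later adaptedness claims about stopped quantities rest on this. -/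
lemma lt_exitVal_congr {k l l' : ℕ} (hl : k < l) (hl' : k < l') :
    k < exitVal γ T l ↔ k < exitVal γ T l' := by
  rw [lt_exitVal_iff, lt_exitVal_iff]
  simp [switchVal, hl, hl']

lemma min_exitVal_congr {k l l' : ℕ} (hl : k < l) (hl' : k < l') :
    min k (exitVal γ T l) = min k (exitVal γ T l') := by
  refine eq_of_forall_lt_iff fun j => ?_
  rw [lt_min_iff, lt_min_iff]
  exact and_congr_right fun h => lt_exitVal_congr (h.trans hl) (h.trans hl')

lemma regimeVal_of_lt {k l : ℕ} (h : k < l) : regimeVal l k = 1 := if_neg h.ne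

lemma fairStopVal_congr {k l l' : ℕ} (hl : k < l) (hl' : k < l') :
    fairStopVal γ T l k = fairStopVal γ T l' k := by
  unfold fairStopVal
  rw [min_exitVal_congr hl hl', regimeVal_of_lt ((min_le_left _ _).trans_lt hl),
    regimeVal_of_lt ((min_le_left _ _).trans_lt hl')]

lemma assetFlowVal_congr {k l l' : ℕ} (hl : k < l) (hl' : k < l') :
    assetFlowVal γ T l k = assetFlowVal γ T l' k := by
  unfold assetFlowVal
  rw [min_exitVal_congr hl hl']
  refine Finset.sum_congr rfl fun i hi => ?_
  have := (Finset.mem_Icc.1 hi).2.trans (min_le_left _ _)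
  rw [regimeVal_of_lt (by omega), regimeVal_of_lt (by omega)]

lemma hedgeFlowVal_congr (a b : ℕ → ℝ) {k l l' : ℕ} (hl : k < l) (hl' : k < l') :
    hedgeFlowVal γ T a b l k = hedgeFlowVal γ T a b l' k := by
  unfold hedgeFlowVal
  rw [min_exitVal_congr hl hl']
  refine Finset.sum_congr rfl fun i hi => ?_
  have := (Finset.mem_Icc.1 hi).2.trans (min_le_left _ _)
  rw [regimeVal_of_lt (by omega), regimeVal_of_lt (by omega)]

lemma hedgePriceVal_congr (a b : ℕ → ℝ) {k l l' : ℕ} (hl : k < l) (hl' : k < l') :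
    hedgePriceVal γ T a b l k = hedgePriceVal γ T a b l' k := by
  unfold hedgePriceVal
  rw [min_exitVal_congr hl hl', regimeVal_of_lt ((min_le_left _ _).trans_lt hl),
    regimeVal_of_lt ((min_le_left _ _).trans_lt hl')]

lemma JeVal_congr {k l l' : ℕ} (hl : k < l) (hl' : k < l') : JeVal γ T l k = JeVal γ T l' k :=
  ind_congr (lt_exitVal_congr hl hl')

lemma DVal_eq (l k : ℕ) : DVal γ T l k =
    condVal γ T k (fun m => JsVal γ T m T * fairStopVal γ T m T) l := rfl

lemma DVal'_eq (l k : ℕ) : DVal' γ T l k =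
    condVal γ T k (fun m => (1 - JsVal γ T m T) * fairStopVal γ T m T) l := rfl

lemma vaDriftVal_eq (l k : ℕ) : vaDriftVal γ T l k = assetFlowVal γ T l k + fairStopVal γ T l k
    - condVal γ T k (fun m => assetFlowVal γ T m T + fairStopVal γ T m T) l := rfl

/-- After the exit, the value of the asset at a switch time is known. -/
lemma one_sub_JeVal_mul_DVal' {k l : ℕ} (hk : k ≤ T) (h1 : 1 ≤ l) (hl : l ≤ T + 1) :
    (1 - JeVal γ T l k) * DVal' γ T l k =
      (1 - JeVal γ T l k) * ((1 - JsVal γ T l T) * fairStopVal γ T l T) := by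
  rw [DVal'_eq]
  rcases Nat.lt_or_ge k l with hkl | hkl
  · rcases hk.eq_or_lt with rfl | hkT
    · rw [condVal_self _ h1 hl]
    by_cases he : k < exitVal γ T l
    · rw [JeVal, ind_of_true he, sub_self, zero_mul, zero_mul]
    -- The trader has left by time `k` while the regime is still normal, so the exit was caused by a
    -- zero price. The same exit occurs in every scenario `m > k`, strictly before the switch. This
    -- needs `k < T`, as the switch time is capped at `T`.
    have hJs : ∀ m, k < m → JsVal γ T m T = 1 := fun m hm => by
      rw [lt_exitVal_congr hkl hm] at he
      refine ind_of_true ?_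
      rw [min_eq_right (exitVal_le m)]
      exact (not_lt.1 he).trans_lt (lt_min hm hkT)
    rw [hJs l hkl]
    congr 1
    unfold condVal
    rw [sub_self, zero_mul]
    refine Finset.sum_eq_zero fun m _ => ?_
    rcases Nat.lt_or_ge k m with hm | hm
    · simp only [hJs m hm]
      ring
    · rw [condProbVal_of_le_of_lt hk hkl hm, mul_zero]
  · rw [condVal_of_le _ hk h1 hkl]

end Exit

/-! ### Stopped processes as functions of the first extreme time -/

section Exit

variable {Ω : Type*} {mΩ : MeasurableSpace Ω} {μ : Measure Ω} {T : ℕ} {γ : ℕ → ℝ≥0}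
  {N : ℕ → Ω → ℕ} {θ : (ℕ → ℕ) → ℕ} {ω : Ω}

lemma exitTime_mem : exitTime μ N T ω = switchTime N T ω ∨
    (exitTime μ N T ω < switchTime N T ω ∧ traderPrice μ N T (exitTime μ N T ω) ω = 0) :=
  Nat.sInf_mem (s := {k | k = switchTime N T ω ∨
    (k < switchTime N T ω ∧ traderPrice μ N T k ω = 0)}) ⟨_, Or.inl rfl⟩

lemma exitTime_le : exitTime μ N T ω ≤ T :=
  (Nat.sInf_le (Or.inl rfl) : exitTime μ N T ω ≤ switchTime N T ω).trans (Nat.sInf_le (Or.inl rfl))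

lemma stopped_of_le (X : ℕ → Ω → ℝ) {k : ℕ} (hk : T ≤ k) :
    stopped μ N T X k ω = atExit μ N T X ω := by
  unfold stopped atExit
  rw [min_eq_right (exitTime_le.trans hk)]

/-- The exit occurs either at the switch, where `J^s = 0`, or earlier because the trader's price is
zero. -/
lemma atExit_Js_mul_traderPrice :
    atExit μ N T (Js N T) ω * atExit μ N T (traderPrice μ N T) ω = 0 := by
  unfold atExit Js
  rcases exitTime_mem (μ := μ) (N := N) (T := T) (ω := ω) with h | h
  · rw [ind_of_false (by omega), zero_mul]
  · rw [h.2, mul_zero]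

lemma Je_of_le {k : ℕ} (hk : T ≤ k) : Je μ N T k ω = 0 :=
  ind_of_false (not_lt.2 (exitTime_le.trans hk))

/-- The first decomposition of the profit and loss. -/
theorem pnl_eq (k : ℕ) (ω : Ω) : pnl μ N T θ k ω =
    (stopped μ N T (assetFlow μ N T) k ω
      + stopped μ N T (Js N T) k ω * stopped μ N T (traderPrice μ N T) k ω
      + (1 - stopped μ N T (Js N T) k ω) * stopped μ N T (fairValue μ N T) k ω
      - (stopped μ N T (hedgeFlow μ N θ) k ω + stopped μ N T (hedgePrice μ N T θ) k ω))
    - (1 - Je μ N T k ω) * (1 - atExit μ N T (Js N T) ω) * atExit μ N T (fairValue μ N T) ω := by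
  unfold pnl
  rw [atExit_Js_mul_traderPrice]
  ring

/-- At maturity the asset value at the exit cancels against the term that removes it. -/
lemma pnl_final (ω : Ω) : pnl μ N T θ T ω = atExit μ N T (assetFlow μ N T) ω
    - (atExit μ N T (hedgeFlow μ N θ) ω + atExit μ N T (hedgePrice μ N T θ) ω) := by
  rw [pnl_eq, Je_of_le le_rfl]
  simp only [stopped_of_le _ le_rfl]
  rw [atExit_Js_mul_traderPrice]
  ring

lemma min_exitVal_le (k l : ℕ) : min k (exitVal γ T l) ≤ min l T :=
  (min_le_right _ _).trans (exitVal_le_switchVal _)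

/-- The prices at `ω` are the explicit functions of the regime. -/
structure IsRegular (μ : Measure Ω) (T : ℕ) (γ : ℕ → ℝ≥0) (N : ℕ → Ω → ℕ)
    (θ : (ℕ → ℕ) → ℕ) (ω : Ω) : Prop where
  zero : regime N 0 ω = 1
  fair : ∀ k ≤ T, fairValue μ N T k ω = fairVal γ T k (regime N k ω)
  trader : ∀ k ≤ T, regime N k ω = 1 → traderPrice μ N T k ω = traderVal γ T k k 1
  hedge : ∀ k ≤ T, hedgePrice μ N T θ k ω = ∑ ℓ ∈ Ioc k T,
      (hedgeA μ N θ ℓ * binaryVal γ k ℓ (regime N k ω)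
        - hedgeB μ N θ ℓ * (1 - binaryVal γ k ℓ (regime N k ω)))

lemma IsMarket.ae_isRegular (hM : IsMarket μ T γ N) [IsProbabilityMeasure μ]
    (θ : (ℕ → ℕ) → ℕ) : ∀ᵐ ω ∂μ, IsRegular μ T γ N θ ω := by
  have h1 := (Filter.eventually_all_finset (l := ae μ) (range (T + 1))).2 fun k hk =>
    hM.fairValue_ae (Nat.lt_succ_iff.1 (Finset.mem_range.1 hk))
  have h2 := (Filter.eventually_all_finset (l := ae μ) (range (T + 1))).2 fun k hk =>
    hM.traderPrice_ae (Nat.lt_succ_iff.1 (Finset.mem_range.1 hk))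
  have h3 := (Filter.eventually_all_finset (l := ae μ) (range (T + 1))).2 fun k _ =>
    hM.hedgePrice_ae θ (k := k)
  filter_upwards [h1, h2, h3] with ω h1 h2 h3
  exact ⟨hM.regime_zero ω, fun k hk => h1 k (Finset.mem_range.2 (Nat.lt_succ_of_le hk)),
    fun k hk => h2 k (Finset.mem_range.2 (Nat.lt_succ_of_le hk)),
    fun k hk => h3 k (Finset.mem_range.2 (Nat.lt_succ_of_le hk))⟩

namespace IsRegular

variable (h : IsRegular μ T γ N θ ω)

include h

lemma firstTime_pos : 1 ≤ firstTime N T ω := RangeAccrual.firstTime_pos h.zero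

lemma exitTime_eq : exitTime μ N T ω = exitVal γ T (firstTime N T ω) := by
  unfold exitTime exitVal
  rw [switchTime_eq]
  congr 1
  ext k
  refine or_congr_right (and_congr_right fun hk => ?_)
  have hk' := lt_min_iff.1 hk
  rw [h.trader k hk'.2.le (regime_of_lt_firstTime hk'.1)]

lemma stopped_fairValue (k : ℕ) : stopped μ N T (fairValue μ N T) k ω =
    fairStopVal γ T (firstTime N T ω) k := by
  unfold stopped fairStopVal
  rw [h.exitTime_eq, h.fair _ ((min_exitVal_le _ _).trans (min_le_right _ _)),
    regime_eq_regimeVal (min_exitVal_le _ _)]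

lemma atExit_fairValue : atExit μ N T (fairValue μ N T) ω =
    fairStopVal γ T (firstTime N T ω) T := by
  rw [← h.stopped_fairValue, stopped_of_le _ le_rfl]

lemma stopped_Js (k : ℕ) : stopped μ N T (Js N T) k ω = JsVal γ T (firstTime N T ω) k := by
  unfold stopped Js JsVal
  rw [h.exitTime_eq, switchTime_eq]

lemma atExit_Js : atExit μ N T (Js N T) ω = JsVal γ T (firstTime N T ω) T := by
  rw [← h.stopped_Js, stopped_of_le _ le_rfl]

lemma Je_eq (k : ℕ) : Je μ N T k ω = JeVal γ T (firstTime N T ω) k := by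
  unfold Je JeVal
  rw [h.exitTime_eq]

/-- Stated for the product, because the trader's price is explicit only in the normal regime;
elsewhere the factor `J^s` is zero. -/
lemma stopped_Js_mul_traderPrice (k : ℕ) :
    stopped μ N T (Js N T) k ω * stopped μ N T (traderPrice μ N T) k ω =
      JsVal γ T (firstTime N T ω) k * traderStopVal γ T (firstTime N T ω) k := by
  rw [h.stopped_Js]
  by_cases hlt : min k (exitVal γ T (firstTime N T ω)) < switchVal T (firstTime N T ω)
  · congr 1
    unfold stopped traderStopVal
    have hlt' := lt_min_iff.1 hlt
    rw [h.exitTime_eq, h.trader _ hlt'.2.le (regime_of_lt_firstTime hlt'.1)]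
  · rw [JsVal, ind_of_false hlt, zero_mul, zero_mul]

lemma stopped_assetFlow (k : ℕ) : stopped μ N T (assetFlow μ N T) k ω =
    assetFlowVal γ T (firstTime N T ω) k := by
  unfold stopped assetFlow assetFlowVal
  rw [h.exitTime_eq]
  refine Finset.sum_congr rfl fun l hl => ?_
  rw [Finset.mem_Icc] at hl
  rw [ind_of_true (hl.2.trans (min_le_right _ _)), mul_one,
    regime_eq_regimeVal (hl.2.trans (min_exitVal_le _ _))]

lemma atExit_assetFlow : atExit μ N T (assetFlow μ N T) ω =
    assetFlowVal γ T (firstTime N T ω) T := by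
  rw [← h.stopped_assetFlow, stopped_of_le _ le_rfl]

lemma stopped_hedgeFlow (k : ℕ) : stopped μ N T (hedgeFlow μ N θ) k ω =
    hedgeFlowVal γ T (hedgeA μ N θ) (hedgeB μ N θ) (firstTime N T ω) k := by
  unfold stopped hedgeFlow hedgeFlowVal
  rw [h.exitTime_eq]
  refine Finset.sum_congr rfl fun l hl => ?_
  rw [regime_eq_regimeVal ((Finset.mem_Icc.1 hl).2.trans (min_exitVal_le _ _))]

lemma stopped_hedgePrice (k : ℕ) : stopped μ N T (hedgePrice μ N T θ) k ω =
    hedgePriceVal γ T (hedgeA μ N θ) (hedgeB μ N θ) (firstTime N T ω) k := by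
  unfold stopped hedgePriceVal
  rw [h.exitTime_eq, h.hedge _ ((min_exitVal_le _ _).trans (min_le_right _ _)),
    regime_eq_regimeVal (min_exitVal_le _ _)]

lemma pnl_eq_pnlVal (k : ℕ) : pnl μ N T θ k ω =
    pnlVal γ T (hedgeA μ N θ) (hedgeB μ N θ) (firstTime N T ω) k := by
  rw [pnl_eq, h.stopped_Js_mul_traderPrice, h.stopped_assetFlow, h.stopped_Js,
    h.stopped_fairValue, h.stopped_hedgeFlow, h.stopped_hedgePrice, h.Je_eq, h.atExit_Js,
    h.atExit_fairValue, pnlVal]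
  ring

end IsRegular

namespace IsMarket

variable (hM : IsMarket μ T γ N) [IsProbabilityMeasure μ]

include hM

/-- The exit time is built from versions of conditional expectations and agrees only almost surely
with its explicit form. This almost sure adaptedness is all that `condExp_stopped_sub` asks for. -/
lemma aestronglyMeasurable_ind_lt_exitTime {k : ℕ} (hk : k ≤ T) :
    AEStronglyMeasurable[filt μ N k] (fun ω => ind (k < exitTime μ N T ω)) μ := by
  refine ⟨fun ω => JeVal γ T (firstTime N T ω) k,
    hM.stronglyMeasurable_firstTime hk fun l hl _ => JeVal_congr hl (Nat.lt_succ_self k), ?_⟩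
  -- The exit does not involve the hedge, so any rule can be supplied here.
  filter_upwards [hM.ae_isRegular fun _ => 0] with ω h
  exact h.Je_eq k

/-- Conditional expectations of processes at the exit time. -/
lemma condExp_of_ae_eq {k : ℕ} (hk : k ≤ T) {X : Ω → ℝ} {ξ : ℕ → ℝ}
    (h : X =ᵐ[μ] fun ω => ξ (firstTime N T ω)) :
    μ[X | filt μ N k] =ᵐ[μ] fun ω => condVal γ T k ξ (firstTime N T ω) :=
  (condExp_congr_ae h).trans (hM.condExp_firstTime hk ξ)

lemma DProc_ae {k : ℕ} (hk : k ≤ T) :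
    DProc μ N T k =ᵐ[μ] fun ω => DVal γ T (firstTime N T ω) k := by
  refine hM.condExp_of_ae_eq hk ?_
  filter_upwards [hM.ae_isRegular fun _ => 0] with ω h
  rw [h.atExit_Js, h.atExit_fairValue]

lemma DProc'_ae {k : ℕ} (hk : k ≤ T) :
    DProc' μ N T k =ᵐ[μ] fun ω => DVal' γ T (firstTime N T ω) k := by
  refine hM.condExp_of_ae_eq hk ?_
  filter_upwards [hM.ae_isRegular fun _ => 0] with ω h
  rw [h.atExit_Js, h.atExit_fairValue]

lemma condExp_atExit_asset_ae {k : ℕ} (hk : k ≤ T) :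
    μ[fun ω => atExit μ N T (assetFlow μ N T) ω + atExit μ N T (fairValue μ N T) ω
      | filt μ N k] =ᵐ[μ] fun ω =>
        condVal γ T k (fun m => assetFlowVal γ T m T + fairStopVal γ T m T)
          (firstTime N T ω) := by
  refine hM.condExp_of_ae_eq hk ?_
  filter_upwards [hM.ae_isRegular fun _ => 0] with ω h
  rw [h.atExit_assetFlow, h.atExit_fairValue]

/-- The conditional increment of a stopped process that is explicit in the first time. -/
lemma condExp_stopped_increment {k : ℕ} (hk : k ≤ T) {X : ℕ → Ω → ℝ} {f g : ℕ → ℝ}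
    (hg : ∀ᵐ ω ∂μ, stopped μ N T X T ω = g (firstTime N T ω))
    (hf : ∀ᵐ ω ∂μ, stopped μ N T X k ω = f (firstTime N T ω))
    (hfc : ∀ l, k < l → l ≤ T + 1 → f l = f (k + 1)) :
    μ[fun ω => stopped μ N T X T ω - stopped μ N T X k ω | filt μ N k] =ᵐ[μ]
      fun ω => condVal γ T k g (firstTime N T ω) - f (firstTime N T ω) := by
  have h1 : (fun ω => stopped μ N T X T ω - stopped μ N T X k ω) =ᵐ[μ]
      (fun ω => g (firstTime N T ω)) - fun ω => f (firstTime N T ω) := by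
    filter_upwards [hf, hg] with ω h1 h2
    rw [h1, h2]
    rfl
  refine (condExp_congr_ae h1).trans ((condExp_sub (hM.integrable_firstTime g)
    (hM.integrable_firstTime f) _).trans ?_)
  rw [hM.condExp_firstTime_of_const hk hfc]
  exact (hM.condExp_firstTime hk g).sub Filter.EventuallyEq.rfl

lemma integrable_regime_flow (a b : ℝ) (l : ℕ) :
    Integrable (fun ω => a * ind (regime N l ω = -1) - b * ind (regime N l ω = 1)) μ :=
  hM.integrable_apply_regime (fun s => a * ind (s = -1) - b * ind (s = 1)) l

lemma integrable_hedgeFlow (θ : (ℕ → ℕ) → ℕ) (k : ℕ) : Integrable (hedgeFlow μ N θ k) μ :=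
  integrable_finsetSum _ fun _ _ => hM.integrable_regime_flow _ _ _

/-- Past hedge flows plus the fair value of the future ones are the conditional expectation of the
total flow, hence a martingale. -/
lemma condExp_hedge_increment (θ : (ℕ → ℕ) → ℕ) {j : ℕ} (hj : j < T) :
    μ[(fun ω => hedgeFlow μ N θ (j + 1) ω + hedgePrice μ N T θ (j + 1) ω)
      - (fun ω => hedgeFlow μ N θ j ω + hedgePrice μ N T θ j ω) | filt μ N j] =ᵐ[μ] 0 := by
  set f : ℕ → Ω → ℝ := fun ℓ ω => hedgeA μ N θ ℓ * ind (regime N ℓ ω = -1)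
    - hedgeB μ N θ ℓ * ind (regime N ℓ ω = 1) with hf
  have hfi : ∀ ℓ, Integrable (f ℓ) μ := fun ℓ => hM.integrable_regime_flow _ _ _
  set S : ℕ → Ω → ℝ := fun j ω => ∑ ℓ ∈ Ioc j T, f ℓ ω with hS
  have hSi : ∀ j, Integrable (S j) μ := fun j => integrable_finsetSum _ fun ℓ _ => hfi ℓ
  have hP : ∀ j, hedgePrice μ N T θ j = μ[S j | filt μ N j] := fun j => rfl
  have h1 : (fun ω => hedgeFlow μ N θ (j + 1) ω + hedgePrice μ N T θ (j + 1) ω)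
      - (fun ω => hedgeFlow μ N θ j ω + hedgePrice μ N T θ j ω) =
      (f (j + 1) + μ[S (j + 1) | filt μ N (j + 1)]) - μ[S j | filt μ N j] := by
    funext ω
    simp only [Pi.sub_apply, Pi.add_apply, hedgeFlow, hP]
    rw [Finset.sum_Icc_succ_top (by omega)]
    simp only [hf]
    ring
  have h2 : S j = f (j + 1) + S (j + 1) := by
    funext ω
    simp only [hS, Pi.add_apply]
    rw [← Finset.insert_Ioc_add_one_left_eq_Ioc hj, Finset.sum_insert (by simp)]
  have h3 := condExp_condExp_of_le (μ := μ) (f := S (j + 1)) ((filt μ N).mono (Nat.le_succ j))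
    ((filt μ N).le _)
  have h4 := condExp_add (hfi (j + 1)) (hSi (j + 1)) (filt μ N j)
  have h5 := condExp_add (hfi (j + 1))
    (integrable_condExp (μ := μ) (f := S (j + 1)) (m := filt μ N (j + 1))) (filt μ N j)
  have h6 := condExp_sub ((hfi (j + 1)).add
    (integrable_condExp (μ := μ) (f := S (j + 1)) (m := filt μ N (j + 1))))
    (integrable_condExp (μ := μ) (f := S j) (m := filt μ N j)) (filt μ N j)
  rw [condExp_of_stronglyMeasurable ((filt μ N).le j) stronglyMeasurable_condExp
    integrable_condExp] at h6
  rw [h1]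
  rw [← h2] at h4
  filter_upwards [h3, h4, h5, h6] with ω h3 h4 h5 h6
  rw [h6, Pi.sub_apply, h5, Pi.add_apply, h3, h4, Pi.add_apply, sub_self]
  rfl

/-- The stopped hedge is a martingale. -/
theorem condVal_hedge (θ : (ℕ → ℕ) → ℕ) {k : ℕ} (hk : k ≤ T) : ∀ᵐ ω ∂μ,
    condVal γ T k (fun m => hedgeFlowVal γ T (hedgeA μ N θ) (hedgeB μ N θ) m T
      + hedgePriceVal γ T (hedgeA μ N θ) (hedgeB μ N θ) m T) (firstTime N T ω) =
    hedgeFlowVal γ T (hedgeA μ N θ) (hedgeB μ N θ) (firstTime N T ω) k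
      + hedgePriceVal γ T (hedgeA μ N θ) (hedgeB μ N θ) (firstTime N T ω) k := by
  set X : ℕ → Ω → ℝ := fun j ω => hedgeFlow μ N θ j ω + hedgePrice μ N T θ j ω with hX
  have hst : ∀ j, ∀ᵐ ω ∂μ, stopped μ N T X j ω =
      hedgeFlowVal γ T (hedgeA μ N θ) (hedgeB μ N θ) (firstTime N T ω) j
      + hedgePriceVal γ T (hedgeA μ N θ) (hedgeB μ N θ) (firstTime N T ω) j := fun j => by
    filter_upwards [hM.ae_isRegular θ] with ω h
    rw [← h.stopped_hedgeFlow, ← h.stopped_hedgePrice]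
    rfl
  -- The same conditional increment is computed twice: explicitly through the first time, and as a
  -- sum of one-step increments, each of which is null.
  have h1 := hM.condExp_stopped_increment hk (X := X)
    (g := fun m => hedgeFlowVal γ T (hedgeA μ N θ) (hedgeB μ N θ) m T
      + hedgePriceVal γ T (hedgeA μ N θ) (hedgeB μ N θ) m T)
    (f := fun m => hedgeFlowVal γ T (hedgeA μ N θ) (hedgeB μ N θ) m k
      + hedgePriceVal γ T (hedgeA μ N θ) (hedgeB μ N θ) m k) (hst T) (hst k) fun l hl _ => by
        rw [hedgeFlowVal_congr _ _ hl (Nat.lt_succ_self k),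
          hedgePriceVal_congr _ _ hl (Nat.lt_succ_self k)]
  have h2 := condExp_stopped_sub (μ := μ) (filt μ N) (τ := exitTime μ N T) (X := X) hk
    (fun j _ _ => (hM.integrable_hedgeFlow θ j).add integrable_condExp)
    fun j _ hj => hM.aestronglyMeasurable_ind_lt_exitTime hj.le
  have h3 : ∀ j ∈ Ico k T, μ[fun ω => ind (j < exitTime μ N T ω) *
      (μ[X (j + 1) - X j | filt μ N j]) ω | filt μ N k] =ᵐ[μ] 0 := fun j hj => by
    rw [← condExp_zero (μ := μ) (m := filt μ N k)]
    refine condExp_congr_ae ?_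
    filter_upwards [hM.condExp_hedge_increment θ (Finset.mem_Ico.1 hj).2] with ω h
    simp only [hX]
    rw [h]
    simp
  filter_upwards [h1, h2, (Filter.eventually_all_finset (l := ae μ) (Ico k T)).2 h3]
    with ω h1 h2 h3
  have h4 : (fun ω => stopped μ N T X T ω - stopped μ N T X k ω) =
    fun ω => X (min T (exitTime μ N T ω)) ω - X (min k (exitTime μ N T ω)) ω := rfl
  rw [h4, h2, Finset.sum_apply, Finset.sum_eq_zero h3] at h1
  exact (sub_eq_zero.1 h1.symm)

lemma integrable_asset {j : ℕ} (hj : j ≤ T) :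
    Integrable (fun ω => assetFlow μ N T j ω + fairValue μ N T j ω) μ := by
  refine Integrable.add ?_
    ((integrable_congr (hM.fairValue_ae hj)).2 (hM.integrable_apply_regime (fairVal γ T j) j))
  refine integrable_finsetSum _ fun l hl => ?_
  have h := integrable_ind_mul (μ := μ) le_rfl (p := fun ω => l ≤ exitTime μ N T ω) ?_
    (hM.integrable_regime_flow 1 1 l)
  · refine h.congr (Filter.Eventually.of_forall fun ω => ?_)
    simp only
    ring
  -- The event `i + 1 ≤ τ_e` is the event `i < τ_e`, already decided at time `i`.
  · obtain ⟨i, rfl⟩ : ∃ i, l = i + 1 := ⟨l - 1, by have := (Finset.mem_Icc.1 hl).1; omega⟩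
    exact (hM.aestronglyMeasurable_ind_lt_exitTime (k := i)
      (by have := (Finset.mem_Icc.1 hl).2; omega)).mono ((filt μ N).le i)

/-- The increments of `K` are minus the one-step conditional increments of `𝒬 + Q`. Stopped and
summed, they give minus the expected increment of the stopped `𝒬 + Q`, which is explicit in the
first time. -/
theorem vaDrift_ae {k : ℕ} (hk : k ≤ T) :
    vaDrift μ N T k =ᵐ[μ] fun ω => vaDriftVal γ T (firstTime N T ω) k := by
  set X : ℕ → Ω → ℝ := fun j ω => assetFlow μ N T j ω + fairValue μ N T j ω with hX
  have hst : ∀ j, ∀ᵐ ω ∂μ, stopped μ N T X j ω =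
      assetFlowVal γ T (firstTime N T ω) j + fairStopVal γ T (firstTime N T ω) j := fun j => by
    filter_upwards [hM.ae_isRegular fun _ => 0] with ω h
    rw [← h.stopped_assetFlow, ← h.stopped_fairValue]
    rfl
  have h1 := hM.condExp_stopped_increment hk (X := X)
    (g := fun m => assetFlowVal γ T m T + fairStopVal γ T m T)
    (f := fun m => assetFlowVal γ T m k + fairStopVal γ T m k) (hst T) (hst k) fun l hl _ => by
        rw [assetFlowVal_congr hl (Nat.lt_succ_self k), fairStopVal_congr hl (Nat.lt_succ_self k)]
  have hXi : ∀ j, k ≤ j → j ≤ T → Integrable (X j) μ := fun j _ hj => hM.integrable_asset hj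
  have hτ : ∀ j, k ≤ j → j < T → AEStronglyMeasurable[filt μ N j]
    (fun ω => ind (j < exitTime μ N T ω)) μ :=
    fun j _ hj => hM.aestronglyMeasurable_ind_lt_exitTime hj.le
  have h2 := condExp_stopped_sub (μ := μ) (filt μ N) (τ := exitTime μ N T) (X := X) hk hXi hτ
  have h3 : (fun ω => stopped μ N T (drift μ N T) T ω - stopped μ N T (drift μ N T) k ω) =
      -∑ j ∈ Ico k T, fun ω => ind (j < exitTime μ N T ω) *
        (μ[X (j + 1) - X j | filt μ N j]) ω := by
    funext ω
    unfold stopped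
    rw [stopped_sub_eq_sum (fun j => drift μ N T j ω) _ hk, Pi.neg_apply, Finset.sum_apply,
      ← Finset.sum_neg_distrib]
    refine Finset.sum_congr rfl fun j _ => ?_
    simp only [drift]
    rw [predictablePart_add_one, Pi.add_apply]
    ring
  have h4 : vaDrift μ N T k =ᵐ[μ] -∑ j ∈ Ico k T, μ[fun ω => ind (j < exitTime μ N T ω) *
        (μ[X (j + 1) - X j | filt μ N j]) ω | filt μ N k] := by
    unfold vaDrift
    rw [h3]
    refine (condExp_neg _ _).trans (Filter.EventuallyEq.neg (condExp_finsetSum (fun j hj => ?_) _))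
    rw [Finset.mem_Ico] at hj
    exact integrable_ind_mul ((filt μ N).le j) (hτ j hj.1 hj.2) integrable_condExp
  filter_upwards [h1, h2, h4] with ω h1 h2 h4
  have h5 : (fun ω => stopped μ N T X T ω - stopped μ N T X k ω) =
    fun ω => X (min T (exitTime μ N T ω)) ω - X (min k (exitTime μ N T ω)) ω := rfl
  rw [h5, h2] at h1
  rw [h4, Pi.neg_apply, h1, vaDriftVal_eq]
  ring

end IsMarket

end Exit

/-! ### Decompositions of the hedging valuation adjustment -/

section Decomposition

variable {Ω : Type*} {mΩ : MeasurableSpace Ω} {μ : Measure Ω} {T : ℕ} {γ : ℕ → ℝ≥0}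
  {N : ℕ → Ω → ℕ} {θ : (ℕ → ℕ) → ℕ} {ω : Ω}

lemma stopped_min (X : ℕ → Ω → ℝ) (k : ℕ) (ω : Ω) :
    stopped μ N T X (min k T) ω = stopped μ N T X k ω := by
  unfold stopped
  rw [min_assoc, min_eq_right (exitTime_le (μ := μ) (N := N) (ω := ω))]

/-- The profit and loss at maturity, on `Ω_l`. -/
noncomputable def pnlFinalVal (γ : ℕ → ℝ≥0) (T : ℕ) (a b : ℕ → ℝ) (l : ℕ) : ℝ :=
  assetFlowVal γ T l T - (hedgeFlowVal γ T a b l T + hedgePriceVal γ T a b l T)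

lemma condVal_sub (k : ℕ) (ξ η : ℕ → ℝ) (l : ℕ) :
    condVal γ T k (fun m => ξ m - η m) l = condVal γ T k ξ l - condVal γ T k η l := by
  unfold condVal
  rw [← Finset.sum_sub_distrib]
  exact Finset.sum_congr rfl fun m _ => by ring

lemma condVal_fairStopVal (k l : ℕ) : condVal γ T k (fun m => fairStopVal γ T m T) l =
    DVal γ T l k + DVal' γ T l k := by
  rw [DVal_eq, DVal'_eq, ← condVal_add]
  congr 1
  funext m
  ring

/-- The right side is `pnl` minus its expected final value, the hedge being a martingale. Splitting
the asset value at the exit into its `D` and `D'` parts leaves only the discrepancy `(1 - J^e) (D' -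
(1 - J^s) Q)`, which vanishes by `one_sub_JeVal_mul_DVal'`. -/
lemma hvaVal_eq (a b : ℕ → ℝ) {k l : ℕ} (hk : k ≤ T) (h1 : 1 ≤ l) (hl : l ≤ T + 1) :
    hvaVal γ T l k = pnlVal γ T a b l k - (condVal γ T k (fun m => assetFlowVal γ T m T) l
      - (hedgeFlowVal γ T a b l k + hedgePriceVal γ T a b l k)) := by
  have h2 := one_sub_JeVal_mul_DVal' (γ := γ) hk h1 hl
  have h3 := condVal_add (γ := γ) (T := T) k (fun m => assetFlowVal γ T m T)
    (fun m => fairStopVal γ T m T) l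
  rw [condVal_fairStopVal] at h3
  rw [hvaVal, vaDriftVal_eq, pnlVal, h3]
  linear_combination -h2

lemma traderVal_self (k : ℕ) : traderVal γ k k k 1 = 0 := by simp [traderVal, traderDP]

lemma fairStopVal_of_zero (l k : ℕ) : fairStopVal γ 0 l k = 0 := by
  unfold fairStopVal fairVal
  simp [fairDP]

/-- If `T > 0` the switch is later than `0` and the indicator is `1`. If `T = 0` the indicator is
`0`, but both prices vanish. -/
lemma JsVal_mul_sub_zero {l : ℕ} (h1 : 1 ≤ l) :
    JsVal γ T l 0 * (traderStopVal γ T l 0 - fairStopVal γ T l 0) =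
      traderVal γ T 0 0 1 - fairVal γ T 0 1 := by
  unfold JsVal traderStopVal fairStopVal
  rw [Nat.zero_min, regimeVal_of_lt (by omega)]
  rcases Nat.eq_zero_or_pos T with rfl | hT
  · rw [traderVal_self, fairVal_self]
    ring
  · rw [ind_of_true (show 0 < switchVal T l from lt_min h1 hT), one_mul]

/-- An exit at time `0` with `T > 0` happens before the switch, so nothing is left of `(1 - J^s) Q`;
for `T = 0` the asset is worthless. -/
lemma JeVal_zero_mul_DVal' {l : ℕ} (h1 : 1 ≤ l) (hl : l ≤ T + 1) :
    JeVal γ T l 0 * DVal' γ T l 0 = DVal' γ T l 0 := by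
  have h2 := one_sub_JeVal_mul_DVal' (γ := γ) (Nat.zero_le T) h1 hl
  suffices h : (1 - JeVal γ T l 0) * ((1 - JsVal γ T l T) * fairStopVal γ T l T) = 0 by
    linarith
  rcases Nat.eq_zero_or_pos T with rfl | hT
  · rw [fairStopVal_of_zero, mul_zero, mul_zero]
  by_cases h3 : 0 < exitVal γ T l
  · rw [JeVal, ind_of_true h3, sub_self, zero_mul]
  · rw [JsVal, ind_of_true, sub_self, zero_mul, mul_zero]
    rw [min_eq_right (exitVal_le l), Nat.eq_zero_of_not_pos h3]
    exact lt_min h1 hT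

namespace IsMarket

variable (hM : IsMarket μ T γ N) [IsProbabilityMeasure μ]

include hM

lemma condExp_pnl_final (θ : (ℕ → ℕ) → ℕ) {k : ℕ} (hk : k ≤ T) :
    μ[pnl μ N T θ T | filt μ N k] =ᵐ[μ] fun ω =>
      condVal γ T k (pnlFinalVal γ T (hedgeA μ N θ) (hedgeB μ N θ)) (firstTime N T ω) := by
  refine hM.condExp_of_ae_eq hk ?_
  filter_upwards [hM.ae_isRegular θ] with ω h
  rw [pnl_final, h.atExit_assetFlow, ← stopped_of_le (hedgeFlow μ N θ) le_rfl,
    ← stopped_of_le (hedgePrice μ N T θ) le_rfl, h.stopped_hedgeFlow, h.stopped_hedgePrice,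
    pnlFinalVal]

theorem hva_ae (θ : (ℕ → ℕ) → ℕ) {k : ℕ} (hk : k ≤ T) :
    ∀ᵐ ω ∂μ, hva μ N T θ k ω = hvaVal γ T (firstTime N T ω) k := by
  filter_upwards [hM.ae_isRegular θ, hM.condExp_pnl_final θ hk, hM.condVal_hedge θ hk]
    with ω h h1 h2
  rw [hva, h1, h.pnl_eq_pnlVal,
    hvaVal_eq (hedgeA μ N θ) (hedgeB μ N θ) hk h.firstTime_pos firstTime_le, ← h2]
  congr 1
  exact condVal_sub _ _ _ _

/-- The decomposition of the hedging valuation adjustment. -/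
theorem hva_decomposition (θ : (ℕ → ℕ) → ℕ) {k : ℕ} (hk : k ≤ T) : ∀ᵐ ω ∂μ,
    hva μ N T θ k ω =
      stopped μ N T (Js N T) k ω
          * (stopped μ N T (traderPrice μ N T) k ω - stopped μ N T (fairValue μ N T) k ω)
        + DProc μ N T k ω + Je μ N T k ω * DProc' μ N T k ω + vaDrift μ N T k ω := by
  filter_upwards [hM.ae_isRegular θ, hM.hva_ae θ hk, hM.DProc_ae hk, hM.DProc'_ae hk,
    hM.vaDrift_ae hk] with ω h h1 h2 h3 h4
  rw [h1, h2, h3, h4, mul_sub, h.stopped_Js_mul_traderPrice, h.stopped_Js, h.stopped_fairValue,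
    h.Je_eq, hvaVal]
  ring

theorem vaDrift_decomposition {k : ℕ} (hk : k ≤ T) : ∀ᵐ ω ∂μ,
    vaDrift μ N T k ω =
      stopped μ N T (assetFlow μ N T) k ω + stopped μ N T (fairValue μ N T) k ω
        - (μ[fun ω' => atExit μ N T (assetFlow μ N T) ω' + atExit μ N T (fairValue μ N T) ω'
            | filt μ N k]) ω := by
  filter_upwards [hM.ae_isRegular fun _ => 0, hM.vaDrift_ae hk, hM.condExp_atExit_asset_ae hk]
    with ω h h1 h2
  rw [h1, h2, h.stopped_assetFlow, h.stopped_fairValue, vaDriftVal_eq]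

theorem hva_zero_decomposition (θ : (ℕ → ℕ) → ℕ) : ∀ᵐ ω ∂μ,
    hva μ N T θ 0 ω = (traderPrice μ N T 0 ω - fairValue μ N T 0 ω)
      + DProc μ N T 0 ω + DProc' μ N T 0 ω + vaDrift μ N T 0 ω := by
  have h0 := Nat.zero_le T
  filter_upwards [hM.ae_isRegular θ, hM.hva_ae θ h0, hM.DProc_ae h0, hM.DProc'_ae h0,
    hM.vaDrift_ae h0] with ω h h1 h2 h3 h4
  rw [h1, h2, h3, h4, hvaVal, JsVal_mul_sub_zero h.firstTime_pos,
    JeVal_zero_mul_DVal' h.firstTime_pos firstTime_le, h.trader 0 h0 h.zero, h.fair 0 h0, h.zero]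

/-- At time `0` the static hedge costs the trader's price of the asset. -/
theorem traderPrice_zero_eq_hedgePrice (hθ : IsOptimalTraderRule (binaryPrice0 μ N) 0 T 1 θ) :
    ∀ᵐ ω ∂μ, traderPrice μ N T 0 ω = hedgePrice μ N T θ 0 ω := by
  filter_upwards [hM.ae_isRegular θ] with ω h
  rw [h.trader 0 (Nat.zero_le T) h.zero, h.hedge 0 (Nat.zero_le T), h.zero,
    hM.traderVal_zero_eq_hedge hθ]

end IsMarket

end Decomposition

/-! ### Economic capital -/

section Capital

variable {Ω : Type*} {mΩ : MeasurableSpace Ω} {μ : Measure Ω} {T : ℕ} {γ : ℕ → ℝ≥0}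
  {N : ℕ → Ω → ℕ} {θ : (ℕ → ℕ) → ℕ}

lemma condProbVal_nonneg (k m l : ℕ) : 0 ≤ condProbVal γ T k m l := by
  unfold condProbVal
  have h1 : ∀ s : Finset ℕ, 0 ≤ ∏ j ∈ s, uProb γ j := fun s =>
    Finset.prod_nonneg fun j _ => uProb_nonneg j
  split_ifs
  · exact add_nonneg (mul_nonneg (ind_nonneg _) (ind_nonneg _))
      (mul_nonneg (mul_nonneg (mul_nonneg (ind_nonneg _) (ind_nonneg _)) (h1 _)) (vProb_nonneg _))
  · exact mul_nonneg (ind_nonneg _) (h1 _)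

/-- The conditional law given `𝔉_k`, on `Ω_l`, of a function `g` of the first time. -/
noncomputable def lawVal (γ : ℕ → ℝ≥0) (T k : ℕ) (g : ℕ → ℝ) (l : ℕ) : Measure ℝ :=
  ∑ m ∈ Icc 1 (T + 1), ENNReal.ofReal (condProbVal γ T k m l) • Measure.dirac (g m)

instance (k : ℕ) (g : ℕ → ℝ) (l : ℕ) : IsFiniteMeasure (lawVal γ T k g l) := by
  refine ⟨?_⟩
  unfold lawVal
  simp [Measure.finsetSum_apply]

lemma lawVal_apply (k : ℕ) (g : ℕ → ℝ) (l : ℕ) {s : Set ℝ} (hs : MeasurableSet s) :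
    lawVal γ T k g l s =
      ENNReal.ofReal (condVal γ T k (fun m => s.indicator (fun _ => (1 : ℝ)) (g m)) l) := by
  unfold lawVal condVal
  rw [ENNReal.ofReal_sum_of_nonneg fun m _ => mul_nonneg
    (Set.indicator_nonneg (fun _ _ => zero_le_one) _) (condProbVal_nonneg _ _ _),
    Measure.finsetSum_apply]
  refine Finset.sum_congr rfl fun m _ => ?_
  rw [Measure.smul_apply, Measure.dirac_apply' _ hs]
  by_cases h : g m ∈ s <;> simp [h]

lemma lawVal_of_lt {k l : ℕ} (g : ℕ → ℝ) (hk : k ≤ T) (hl : k < l) :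
    lawVal γ T k g l = lawVal γ T k g (T + 1) :=
  Finset.sum_congr rfl fun m _ => by rw [condProbVal_of_lt hk hl]

lemma lawVal_of_le {k l : ℕ} (g : ℕ → ℝ) (hk : k ≤ T) (h1 : 1 ≤ l) (hl : l ≤ k) :
    lawVal γ T k g l = Measure.dirac (g l) := by
  unfold lawVal
  rw [Finset.sum_eq_single l]
  · rw [condProbVal_of_le hk (by omega) hl, ind_of_true rfl, ENNReal.ofReal_one, one_smul]
  · intro m hm hml
    rw [condProbVal_of_le hk (Finset.mem_Icc.1 hm).2 hl, ind_of_false (Ne.symm hml),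
      ENNReal.ofReal_zero, zero_smul]
  · intro h
    exact absurd (Finset.mem_Icc.2 ⟨h1, by omega⟩) h

lemma expectedShortfall_dirac_zero (α : ℝ) : expectedShortfall α (Measure.dirac (0 : ℝ)) = 0 := by
  unfold expectedShortfall
  rw [setIntegral_dirac]
  simp

/-- The loss over one period, on `Ω_l`. -/
noncomputable def lossVal (γ : ℕ → ℝ≥0) (T : ℕ) (a b : ℕ → ℝ) (k l : ℕ) : ℝ :=
  condVal γ T k (pnlFinalVal γ T a b) l - condVal γ T (min (k + 1) T) (pnlFinalVal γ T a b) l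

lemma lossVal_of_le (a b : ℕ → ℝ) {k l : ℕ} (hk : k ≤ T) (h1 : 1 ≤ l) (hl : l ≤ k) :
    lossVal γ T a b k l = 0 := by
  unfold lossVal
  rw [condVal_of_le _ hk h1 hl, condVal_of_le _ (min_le_right _ _) h1 (by omega), sub_self]

namespace IsMarket

variable (hM : IsMarket μ T γ N) [IsProbabilityMeasure μ]

include hM

/-- For each fixed set the kernel agrees almost surely with a conditional probability, given by
`IsMarket.condExp_firstTime`. Open intervals with rational endpoints are countably many and
determine the measure, so one null set suffices. -/
theorem condDistrib_ae {k : ℕ} (hk : k ≤ T) {Y : Ω → ℝ} {g : ℕ → ℝ}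
    (hY : Y =ᵐ[μ] fun ω => g (firstTime N T ω)) : ∀ᵐ ω ∂μ,
    @condDistrib Ω Ω ℝ _ _ _ mΩ (filt μ N k) Y id μ _ ω = lawVal γ T k g (firstTime N T ω) := by
  have hid : @Measurable Ω Ω mΩ (filt μ N k) id := measurable_id.mono le_rfl ((filt μ N).le k)
  have hg : Measurable fun ω => g (firstTime N T ω) :=
    (measurable_of_countable g).comp hM.measurable_firstTime
  have h1 : ∀ s : Set ℝ, MeasurableSet s → ∀ᵐ ω ∂μ,
      (@condDistrib Ω Ω ℝ _ _ _ mΩ (filt μ N k) (fun ω => g (firstTime N T ω)) id μ _ ω).real s =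
      condVal γ T k (fun m => s.indicator (fun _ => (1 : ℝ)) (g m)) (firstTime N T ω) := by
    intro s hs
    have h2 := condDistrib_ae_eq_condExp (mβ := filt μ N k) (X := id) (μ := μ)
      (Y := fun ω => g (firstTime N T ω)) hid hg hs
    rw [MeasurableSpace.comap_id] at h2
    exact h2.trans (hM.condExp_firstTime hk fun m => s.indicator (fun _ => (1 : ℝ)) (g m))
  rw [condDistrib_congr_left hY]
  have h2 : ∀ᵐ ω ∂μ, ∀ a b : ℚ,
      (@condDistrib Ω Ω ℝ _ _ _ mΩ (filt μ N k) (fun ω => g (firstTime N T ω)) id μ _ ω).real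
        (Set.Ioo (a : ℝ) b) =
      condVal γ T k (fun m => (Set.Ioo (a : ℝ) b).indicator (fun _ => (1 : ℝ)) (g m))
        (firstTime N T ω) :=
    ae_all_iff.2 fun a => ae_all_iff.2 fun b => h1 _ measurableSet_Ioo
  filter_upwards [h2] with ω h
  refine Real.measure_ext_Ioo_rat fun a b => ?_
  rw [lawVal_apply _ _ _ measurableSet_Ioo, ← h a b, ofReal_measureReal]

/-- The running `pnl` cancels against its copy inside the HVA, leaving the difference of successive
conditional expectations of the final `pnl`. -/
lemma lossIncr_ae (θ : (ℕ → ℕ) → ℕ) {k : ℕ} (hk : k ≤ T) :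
    lossIncr μ N T θ k =ᵐ[μ] fun ω =>
      lossVal γ T (hedgeA μ N θ) (hedgeB μ N θ) k (firstTime N T ω) := by
  filter_upwards [hM.condExp_pnl_final θ hk,
    hM.condExp_pnl_final θ (min_le_right (k + 1) T)] with ω h1 h2
  unfold lossIncr hva lossVal
  rw [h1, h2]
  ring

/-- Once the extreme regime has occurred, the final `pnl` is known and the loss is a point mass at
`0`. Before that, the conditional law is the one of the representative scenario `T + 1`. -/
theorem econCapital_ae (θ : (ℕ → ℕ) → ℕ) (α : ℝ) {k : ℕ} (hk : k ≤ T) : ∀ᵐ ω ∂μ,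
    econCapital μ N T θ α k ω = if firstTime N T ω ≤ k then 0 else expectedShortfall α
      (lawVal γ T k (lossVal γ T (hedgeA μ N θ) (hedgeB μ N θ) k) (T + 1)) := by
  filter_upwards [hM.condDistrib_ae hk (hM.lossIncr_ae θ hk)] with ω h
  rw [econCapital, condExpectedShortfall, h]
  have hpos : 1 ≤ firstTime N T ω := firstTime_pos (hM.regime_zero ω)
  split_ifs with h1
  · rw [lawVal_of_le _ hk hpos h1, lossVal_of_le _ _ hk hpos h1, expectedShortfall_dirac_zero]
  · rw [lawVal_of_lt _ hk (not_le.1 h1)]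

/-- At time `0` every scenario is still undecided, so the conditional probability is a constant and
equals the unconditional one. -/
lemma measureReal_firstEvent {m : ℕ} (hm : m ∈ Icc 1 (T + 1)) :
    μ.real (firstEvent N T m) = condProbVal γ T 0 m (T + 1) := by
  have h1 : firstEvent N T m = {ω | firstTime N T ω = m} := by
    ext ω
    exact mem_firstEvent_iff (Finset.mem_Icc.1 hm).2
  have hs : MeasurableSet {ω | firstTime N T ω = m} :=
    hM.measurable_firstTime (measurableSet_singleton m)
  have h2 : μ.real {ω | firstTime N T ω = m} = ∫ ω, ind (m = firstTime N T ω) ∂μ := by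
    rw [← integral_indicator_one hs]
    refine integral_congr_ae (Filter.Eventually.of_forall fun ω => ?_)
    by_cases h : firstTime N T ω = m
    · simp [h, ind_of_true]
    · simp [h, ind_of_false (Ne.symm h)]
  rw [h1, h2, ← integral_condExp ((filt μ N).le 0),
    integral_congr_ae (hM.condExp_firstTime (Nat.zero_le T) fun j => ind (m = j))]
  have h3 : ∀ ω, condVal γ T 0 (fun j => ind (m = j)) (firstTime N T ω) =
      condProbVal γ T 0 m (T + 1) := fun ω => by
    rw [condVal_of_lt _ (Nat.zero_le T) (firstTime_pos (hM.regime_zero ω)), condVal,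
      ← sum_mul_ind_eq (fun j => condProbVal γ T 0 j (T + 1)) hm]
    exact Finset.sum_congr rfl fun j _ => mul_comm _ _
  simp [h3]

theorem kva_zero_ae (θ : (ℕ → ℕ) → ℕ) (α r : ℝ) {EC : ℕ → ℝ}
    (hEC : ∀ k ≤ T, ∀ᵐ ω ∂μ,
      econCapital μ N T θ α k ω = if firstTime N T ω ≤ k then 0 else EC k) :
    ∀ᵐ ω ∂μ, kva μ N T θ α r 0 ω =
      r * ∑ k ∈ range T, Real.exp (-r * (k : ℝ)) * EC k
        * ∑ m ∈ Icc (k + 1) (T + 1), μ.real (firstEvent N T m) := by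
  have h1 : (fun ω' => ∑ l ∈ Ico 0 T, Real.exp (-r * ((l : ℝ) - (0 : ℕ)))
      * econCapital μ N T θ α l ω') =ᵐ[μ] fun ω => (fun m => ∑ l ∈ range T,
        Real.exp (-r * (l : ℝ)) * if m ≤ l then 0 else EC l) (firstTime N T ω) := by
    have h2 := (Filter.eventually_all_finset (l := ae μ) (range T)).2 fun k hk =>
      hEC k (Finset.mem_range.1 hk).le
    filter_upwards [h2] with ω h2
    rw [← Finset.range_eq_Ico]
    refine Finset.sum_congr rfl fun l hl => ?_
    rw [h2 l hl, Nat.cast_zero, sub_zero]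
  filter_upwards [hM.condExp_of_ae_eq (Nat.zero_le T) (ξ := fun m => ∑ l ∈ range T,
    Real.exp (-r * (l : ℝ)) * if m ≤ l then 0 else EC l) h1] with ω h
  rw [kva, h, condVal_of_lt _ (Nat.zero_le T) (firstTime_pos (hM.regime_zero ω)), condVal]
  congr 1
  simp_rw [Finset.sum_mul]
  -- Exchanging the sums over dates and scenarios collects, for each date `k`, the scenarios `m > k`
  -- that still carry capital.
  rw [Finset.sum_comm]
  refine Finset.sum_congr rfl fun k _ => ?_
  rw [Finset.mul_sum, ← Finset.sum_subset (s₁ := Icc (k + 1) (T + 1))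
    (Finset.Icc_subset_Icc_left (by omega))]
  · refine Finset.sum_congr rfl fun m hm => ?_
    rw [Finset.mem_Icc] at hm
    rw [if_neg (by omega), hM.measureReal_firstEvent (Finset.mem_Icc.2 ⟨by omega, hm.2⟩)]
  · intro m hm hm'
    rw [Finset.mem_Icc] at hm hm'
    rw [if_pos (by omega), mul_zero, zero_mul]

end IsMarket

end Capital

end RangeAccrual

theorem proposition5p1
    {Ω : Type*} [mΩ : MeasurableSpace Ω] (μ : MeasureTheory.Measure Ω)
    [MeasureTheory.IsProbabilityMeasure μ]
    (T : ℕ) (γ : ℕ → ℝ≥0) (N : ℕ → Ω → ℕ)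
    (hNmeas : ∀ k, Measurable (N k)) (hN0 : ∀ ω, N 0 ω = 0)
    (hNlaw : ∀ l < T, μ.map (fun ω => (N (l + 1) ω : ℤ) - (N l ω : ℤ)) =
      (ProbabilityTheory.poissonMeasure (γ l)).map (fun n : ℕ => (n : ℤ)))
    (hNind : ProbabilityTheory.iIndepFun
      (fun (l : Fin T) ω => (N ((l : ℕ) + 1) ω : ℤ) - (N l ω : ℤ)) μ)
    (θ : (ℕ → ℕ) → ℕ)
    (hθ : IsOptimalTraderRule (binaryPrice0 μ N) 0 T 1 θ)
    (α : ℝ) (hα : 1 / 2 < α) (hα1 : α < 1) (r : ℝ) (hr : 0 < r) :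
    -- (i) decompositions of `pnl`, of `HVA`, of the compensated `pnl` and of its increments
    (∀ k ≤ T, ∀ᵐ ω ∂μ,
      pnl μ N T θ k ω =
        (stopped μ N T (assetFlow μ N T) k ω
          + stopped μ N T (Js N T) k ω
            * stopped μ N T (traderPrice μ N T) k ω
          + (1 - stopped μ N T (Js N T) k ω)
            * stopped μ N T (fairValue μ N T) k ω
          - (stopped μ N T (hedgeFlow μ N θ) k ω
            + stopped μ N T (hedgePrice μ N T θ) k ω))
        - (1 - Je μ N T k ω)
          * (1 - atExit μ N T (Js N T) ω)
          * atExit μ N T (fairValue μ N T) ω) ∧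
    (∀ k ≤ T, ∀ᵐ ω ∂μ,
      hva μ N T θ k ω =
        stopped μ N T (Js N T) k ω
            * (stopped μ N T (traderPrice μ N T) k ω
              - stopped μ N T (fairValue μ N T) k ω)
          + DProc μ N T k ω
          + Je μ N T k ω * DProc' μ N T k ω
          + vaDrift μ N T k ω) ∧
    (∀ k ≤ T, ∀ᵐ ω ∂μ,
      vaDrift μ N T k ω =
        stopped μ N T (assetFlow μ N T) k ω
          + stopped μ N T (fairValue μ N T) k ω
          - (μ[fun ω' => atExit μ N T (assetFlow μ N T) ω'
              + atExit μ N T (fairValue μ N T) ω'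
              | filt μ N k]) ω) ∧
    (∀ᵐ ω ∂μ,
      hva μ N T θ 0 ω =
        (traderPrice μ N T 0 ω - fairValue μ N T 0 ω)
          + DProc μ N T 0 ω + DProc' μ N T 0 ω
          + vaDrift μ N T 0 ω) ∧
    (∀ k ≤ T, ∀ᵐ ω ∂μ,
      -pnl μ N T θ k ω
          + (hva μ N T θ k ω - hva μ N T θ 0 ω) =
        (-(stopped μ N T (assetFlow μ N T) k ω
            + stopped μ N T (fairValue μ N T) k ω)
          + stopped μ N T (hedgeFlow μ N θ) k ω
          + stopped μ N T (hedgePrice μ N T θ) k ω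
          + (1 - Je μ N T k ω)
            * (1 - atExit μ N T (Js N T) ω)
            * atExit μ N T (fairValue μ N T) ω)
        + (DProc μ N T k ω
          + Je μ N T k ω * DProc' μ N T k ω
          + vaDrift μ N T k ω)
        + (fairValue μ N T 0 ω - hedgePrice μ N T θ 0 ω)
        - (DProc μ N T 0 ω + DProc' μ N T 0 ω
          + vaDrift μ N T 0 ω)) ∧
    (∀ k ≤ T, ∀ᵐ ω ∂μ,
      hva μ N T θ (min (k + 1) T) ω - hva μ N T θ k ω
          - (pnl μ N T θ (min (k + 1) T) ω - pnl μ N T θ k ω) =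
        (-(stopped μ N T (assetFlow μ N T) (k + 1) ω
            + stopped μ N T (fairValue μ N T) (k + 1) ω)
          + stopped μ N T (hedgeFlow μ N θ) (k + 1) ω
          + stopped μ N T (hedgePrice μ N T θ) (k + 1) ω
          + (stopped μ N T (assetFlow μ N T) k ω
            + stopped μ N T (fairValue μ N T) k ω)
          - stopped μ N T (hedgeFlow μ N θ) k ω
          - stopped μ N T (hedgePrice μ N T θ) k ω
          + (1 - Je μ N T (min (k + 1) T) ω)
            * (1 - atExit μ N T (Js N T) ω)
            * atExit μ N T (fairValue μ N T) ω
          - (1 - Je μ N T k ω)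
            * (1 - atExit μ N T (Js N T) ω)
            * atExit μ N T (fairValue μ N T) ω)
        + (DProc μ N T (min (k + 1) T) ω
          + Je μ N T (min (k + 1) T) ω * DProc' μ N T (min (k + 1) T) ω
          + vaDrift μ N T (min (k + 1) T) ω
          - DProc μ N T k ω
          - Je μ N T k ω * DProc' μ N T k ω
          - vaDrift μ N T k ω)) ∧
    -- (ii) constancy on the events `Ω_l`, with explicitly computable values
    (∀ k ≤ T, ∀ l ∈ Finset.Icc 1 (T + 1), ∀ᵐ ω ∂μ, ω ∈ firstEvent N T l →
      pnl μ N T θ k ω =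
        pnlVal γ T (hedgeA μ N θ) (hedgeB μ N θ) l k ∧
      hva μ N T θ k ω = hvaVal γ T l k ∧
      -pnl μ N T θ k ω
          + (hva μ N T θ k ω - hva μ N T θ 0 ω) =
        -pnlVal γ T (hedgeA μ N θ) (hedgeB μ N θ) l k
          + (hvaVal γ T l k - hvaVal γ T l 0)) ∧
    -- (iii) economic capital and capital valuation adjustment
    (∃ EC : ℕ → ℝ,
      (∀ k ≤ T, ∀ l ∈ Finset.Icc 1 (T + 1), ∀ᵐ ω ∂μ, ω ∈ firstEvent N T l →
        econCapital μ N T θ α k ω = if l ≤ k then 0 else EC k) ∧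
      (∀ᵐ ω ∂μ, kva μ N T θ α r 0 ω =
        r * ∑ k ∈ Finset.range T, Real.exp (-r * (k : ℝ)) * EC k
          * ∑ m ∈ Finset.Icc (k + 1) (T + 1), μ.real (firstEvent N T m))) := by
  have hM : IsMarket μ T γ N := ⟨hNmeas, hN0, hNlaw, hNind⟩
  have hP := hM.traderPrice_zero_eq_hedgePrice hθ
  refine ⟨fun k _ => Filter.Eventually.of_forall fun ω => pnl_eq k ω,
    fun k hk => hM.hva_decomposition θ hk, fun k hk => hM.vaDrift_decomposition hk,
    hM.hva_zero_decomposition θ, fun k hk => ?_, fun k hk => ?_, fun k hk l hl => ?_,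
    -- The capital in the scenario `T + 1`, representative of all scenarios still normal at time
    -- `k`.
    fun k => expectedShortfall α
      (lawVal γ T k (lossVal γ T (hedgeA μ N θ) (hedgeB μ N θ) k) (T + 1)),
    fun k hk l hl => ?_, hM.kva_zero_ae θ α r fun k hk => hM.econCapital_ae θ α hk⟩
  -- The equality `q_0 = P_0` turns the initial term `-(q_0 - Q_0)` of `-HVA_0` into `Q_0 - P_0`.
  · filter_upwards [hM.hva_decomposition θ hk, hM.hva_zero_decomposition θ, hP] with ω h1 h2 h3
    rw [h1, h2, pnl_eq, h3]
    ring
  · have hk' : min (k + 1) T ≤ T := min_le_right _ _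
    filter_upwards [hM.hva_decomposition θ hk, hM.hva_decomposition θ hk'] with ω h1 h2
    rw [h1, h2, pnl_eq, pnl_eq]
    simp only [stopped_min]
    ring
  · filter_upwards [hM.ae_isRegular θ, hM.hva_ae θ hk, hM.hva_ae θ (Nat.zero_le T)]
      with ω h h1 h2 hω
    rw [mem_firstEvent_iff (Finset.mem_Icc.1 hl).2] at hω
    rw [h1, h2, h.pnl_eq_pnlVal, hω]
    exact ⟨rfl, rfl, rfl⟩
  · filter_upwards [hM.econCapital_ae θ α hk] with ω h hω
    rw [mem_firstEvent_iff (Finset.mem_Icc.1 hl).2] at hω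
    rw [h, hω]
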